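/- Let $q\in(-1,0)\cup(0,1)$. Let $\mathcal{P}_{\leq 1}(\mathbb{R})$ be the set of compactly supported probability measures on $\mathbb{R}$ that are absolutely continuous with respect to Lebesgue measure with a density bounded by $1$. Let $MK_{(q)}$ be the $q$-deformed Markov–Krein map: it sends a compactly supported probability measure $\mu$ on $\mathbb{R}$ with density bounded by $1/|q|$ to the unique compactly supported probability measure $\nu$ on $\mathbb{R}$ such that, for all complex $z$ near $0$, $$\exp\Big(-q\sum_{k\ge 0}\mu_k z^{k+1}\Big)=1-q\sum_{k\ge 0}\nu_k z^{k+1},$$ where $\mu_k,\nu_k$ denote the $k$-th moments of $\mu,\nu$. For an integer $r\ge 1$ and real numbers $\alpha_1<\beta_1<\alpha_2<\beta_2<\cdots<\alpha_r<\beta_r$ with $\sum_{i=1}^r(\beta_i-\alpha_i)=1$, let $$f^{(q)}_{\alpha,\beta}(x)=\frac{\sin(\pi q)}{\pi q}\prod_{i=1}^r|x-\alpha_i|^{-q}|x-\beta_i|^{q}\quad\text{for } x\in\bigcup_{i=1}^r[\alpha_i,\beta_i],\qquad f^{(q)}_{\alpha,\beta}(x)=0\text{ otherwise.}$$ Then every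 $f^{(q)}_{\alpha,\beta}$ is a probability density, and the set $\mathcal{P}^{(q)}_{\alpha,\beta}(\mathbb{R})$ of all probability measures $f^{(q)}_{\alpha,\beta}(x)\,dx$ (over all such $r,\alpha,\beta$) is a dense subset of $MK_{(q)}(\mathcal{P}_{\leq 1}(\mathbb{R}))$: it is contained in $MK_{(q)}(\mathcal{P}_{\leq 1}(\mathbb{R}))$, and every element of $MK_{(q)}(\mathcal{P}_{\leq 1}(\mathbb{R}))$ lies in its closure for the topology of weak convergence of probability measures and is moreover the limit of a sequence from $\mathcal{P}^{(q)}_{\alpha,\beta}(\mathbb{R})$ that converges both weakly and in the sense of moments (all moments converge). -/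

import Mathlib

open MeasureTheory Filter Topology

noncomputable section

/-- The compactly supported probability measures on the real line that have a probability density
with respect to Lebesgue measure bounded by `c`. -/
def BoundedDensity (c : ℝ) : Set (ProbabilityMeasure ℝ) :=
  {μ | IsCompact (μ : Measure ℝ).support ∧
    ∃ f : ℝ → ℝ, Measurable f ∧ (∀ x, 0 ≤ f x ∧ f x ≤ c) ∧
      (μ : Measure ℝ) = volume.withDensity (fun x => ENNReal.ofReal (f x))}

/-- The generating function `∑ₖ μₖ z ^ (k + 1)` of the moments `μₖ` of `μ`. -/
def momentSeries (μ : ProbabilityMeasure ℝ) (z : ℂ) : ℂ :=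
  ∑' k : ℕ, ((∫ t : ℝ, t ^ k ∂(μ : Measure ℝ) : ℝ) : ℂ) * z ^ (k + 1)

/-- The graph of the `q`-deformed Markov-Krein map, which sends a compactly supported probability
measure `μ` with density at most `1 / |q|` to the compactly supported probability measure `ν` with
`exp (- q ∑ₖ μₖ z ^ (k + 1)) = 1 - q ∑ₖ νₖ z ^ (k + 1)`. Both series converge for `z` close to
zero, since the supports are compact, and the moments determine `ν`. -/
def IsMarkovKrein (q : ℝ) (μ ν : ProbabilityMeasure ℝ) : Prop :=
  μ ∈ BoundedDensity (1 / |q|) ∧ IsCompact (ν : Measure ℝ).support ∧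
    ∀ᶠ z in 𝓝 (0 : ℂ),
      Complex.exp (-(q : ℂ) * momentSeries μ z) = 1 - (q : ℂ) * momentSeries ν z

/-- The image of a set of measures under the `q`-deformed Markov-Krein map. -/
def markovKreinImage (q : ℝ) (S : Set (ProbabilityMeasure ℝ)) : Set (ProbabilityMeasure ℝ) :=
  {ν | ∃ μ ∈ S, IsMarkovKrein q μ ν}

/-- `α₁ < β₁ < α₂ < β₂ < ⋯ < αᵣ < βᵣ`, and the intervals `[αᵢ, βᵢ]` have total length one. -/
def IsIntervalSystem {r : ℕ} (α β : Fin r → ℝ) : Prop :=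
  (∀ i, α i < β i) ∧ (∀ i j, i < j → β i < α j) ∧ ∑ i, (β i - α i) = 1

/-- The function that equals `sin (π q) / (π q) * ∏ᵢ |x - αᵢ| ^ (-q) * |x - βᵢ| ^ q` on the union
of the intervals `[αᵢ, βᵢ]`, and zero elsewhere. -/
def intervalDensity (q : ℝ) {r : ℕ} (α β : Fin r → ℝ) : ℝ → ℝ :=
  (⋃ i, Set.Icc (α i) (β i)).indicator fun x =>
    Real.sin (Real.pi * q) / (Real.pi * q) * ∏ i, (|x - α i| ^ (-q) * |x - β i| ^ q)

/-- The measure with density `intervalDensity q α β`. -/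
def intervalMeasure (q : ℝ) {r : ℕ} (α β : Fin r → ℝ) : Measure ℝ :=
  volume.withDensity fun x => ENNReal.ofReal (intervalDensity q α β x)

/-- The probability measures with a density `intervalDensity q α β`. -/
def intervalFamily (q : ℝ) : Set (ProbabilityMeasure ℝ) :=
  {ν | ∃ (r : ℕ) (α β : Fin r → ℝ), IsIntervalSystem α β ∧
    (ν : Measure ℝ) = intervalMeasure q α β}

end

/-! Write `R(x) = ∏ᵢ (x - βᵢ) / (x - αᵢ)`. The measure with density `f^{(q)}_{α,β}` is the
Markov-Krein image of the uniform measure on `⋃ [αᵢ, βᵢ]`. On the uniform side, the logarithm series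
gives `exp (-q ∑ μₖ z ^ (k + 1)) = R(1/z) ^ q`. On the other side the density is a constant times
`|R| ^ q`. Interlacing makes `R` an increasing bijection from each `(αᵢ, βᵢ)` onto `(-∞, 0)`, so one
substitutes `s = -R(x)` on every interval. The sum over the branches is a partial fraction expansion
of `1 / (R(w) + s)` (`IsIntervalSystem.sum_inv_ratioDeriv`), and a classical Beta integral yields
the Stieltjes transform `(1 - R(w) ^ q) / q`. With `w = 1/z` the two sides agree, and the
coefficient of `z` shows that the mass is one.

For density, a compactly supported measure with density at most one is approximated in moments by
uniform measures on unions of intervals: the bound leaves room in each small cell for an interval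
whose length is the mass of the cell, up to a small correction. The exponential relation makes each
`νₖ` a polynomial in `μ₀, …, μₖ`, so the moments of the images converge too (`tendsto_of_exp_eq`).
The supports stay in a fixed compact set, hence weak convergence follows. -/

/-! ### Power series and the exponential relation between their coefficients -/

/-- The coefficients of `∑ₖ aₖ z ^ (k + 1)`. -/
def shiftCoeff (a : ℕ → ℝ) : ℕ → ℝ
  | 0 => 0
  | k + 1 => a k

/-- The function `∑ₖ aₖ z ^ (k + 1)`. -/
noncomputable def shiftSeries (a : ℕ → ℝ) (z : ℂ) : ℂ :=
  ∑' k : ℕ, (a k : ℂ) * z ^ (k + 1)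

theorem hasSum_shiftSeries {a : ℕ → ℝ} {C ρ : ℝ} (ha : ∀ k, |a k| ≤ C * ρ ^ k) {z : ℂ}
    (hz : ρ * ‖z‖ < 1) (hρ : 0 ≤ ρ) :
    HasSum (fun k : ℕ => (a k : ℂ) * z ^ (k + 1)) (shiftSeries a z) := by
  refine Summable.hasSum (Summable.of_norm_bounded (g := fun k => C * ‖z‖ * (ρ * ‖z‖) ^ k)
    ((summable_geometric_of_lt_one (by positivity) hz).mul_left _) fun k => ?_)
  rw [norm_mul, norm_pow, Complex.norm_real, Real.norm_eq_abs]
  calc |a k| * ‖z‖ ^ (k + 1) ≤ C * ρ ^ k * ‖z‖ ^ (k + 1) := by gcongr; exact ha k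
    _ = _ := by ring

theorem hasFPowerSeriesAt_shiftSeries {a : ℕ → ℝ} {C ρ : ℝ} (ha : ∀ k, |a k| ≤ C * ρ ^ k)
    (hρ : 0 ≤ ρ) :
    HasFPowerSeriesAt (shiftSeries a)
      (FormalMultilinearSeries.ofScalars ℂ fun n => (shiftCoeff a n : ℂ)) 0 := by
  rw [hasFPowerSeriesAt_iff]
  have h : ∀ᶠ z : ℂ in 𝓝 0, ρ * ‖z‖ < 1 := by
    have : Tendsto (fun z : ℂ => ρ * ‖z‖) (𝓝 0) (𝓝 0) := by
      have : Continuous fun z : ℂ => ρ * ‖z‖ := by fun_prop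
      simpa using this.tendsto 0
    exact this.eventually_lt_const one_pos
  filter_upwards [h] with z hz
  simp only [FormalMultilinearSeries.coeff_ofScalars, zero_add, smul_eq_mul]
  rw [← hasSum_nat_add_iff' 1]
  simpa [shiftCoeff, mul_comm] using hasSum_shiftSeries ha hz hρ

theorem iteratedDeriv_shiftSeries {a : ℕ → ℝ} {C ρ : ℝ} (ha : ∀ k, |a k| ≤ C * ρ ^ k)
    (hρ : 0 ≤ ρ) (n : ℕ) :
    iteratedDeriv n (shiftSeries a) 0 = n.factorial * (shiftCoeff a n : ℂ) := by
  have h1 := hasFPowerSeriesAt_shiftSeries ha hρ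
  have h2 := h1.analyticAt.hasFPowerSeriesAt
  have h3 := congrArg (fun p => p.coeff n) (h1.eq_formalMultilinearSeries h2)
  simp only [FormalMultilinearSeries.coeff_ofScalars] at h3
  rw [h3, mul_div_cancel₀ _ (Nat.cast_ne_zero.2 n.factorial_ne_zero)]

/-- The Taylor derivatives at zero of `1 - q ∑ₖ bₖ z ^ (k + 1)`. -/
noncomputable def taylorDeriv (q : ℝ) (b : ℕ → ℝ) : ℕ → ℝ
  | 0 => 1
  | k + 1 => (k + 1).factorial * (-q * b k)

/-- If `E = exp L` near zero then `E' = L' E`; the Leibniz rule for the `n`-th derivative at zero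
gives a recursion for the Taylor derivatives of `E`. -/
theorem taylorDeriv_succ_of_exp_eq {q : ℝ} {a b : ℕ → ℝ} {C ρ C' ρ' : ℝ}
    (ha : ∀ k, |a k| ≤ C * ρ ^ k) (hρ : 0 ≤ ρ) (hb : ∀ k, |b k| ≤ C' * ρ' ^ k) (hρ' : 0 ≤ ρ')
    (h : ∀ᶠ z in 𝓝 (0 : ℂ), Complex.exp (-(q : ℂ) * shiftSeries a z) = 1 - q * shiftSeries b z)
    (n : ℕ) :
    taylorDeriv q b (n + 1) = ∑ i ∈ Finset.range (n + 1),
      (n.choose i : ℝ) * ((i + 1).factorial * (-q * a i)) * taylorDeriv q b (n - i) := by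
  have hA := (hasFPowerSeriesAt_shiftSeries ha hρ).analyticAt
  have hB := (hasFPowerSeriesAt_shiftSeries hb hρ').analyticAt
  set E : ℂ → ℂ := fun z => 1 - q * shiftSeries b z with hE
  have hEan : AnalyticAt ℂ E 0 := analyticAt_const.sub (analyticAt_const.mul hB)
  set L : ℂ → ℂ := fun z => -(q : ℂ) * shiftSeries a z with hL
  have hLan : AnalyticAt ℂ L 0 := analyticAt_const.mul hA
  have hderiv : deriv E =ᶠ[𝓝 0] deriv L * E := by
    have h1 : (fun z => Complex.exp (L z)) =ᶠ[𝓝 0] E := h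
    filter_upwards [h1.eventuallyEq_nhds, hLan.eventually_analyticAt] with z hz hz2
    rw [← hz.deriv_eq, Pi.mul_apply, ← hz.eq_of_nhds,
      hz2.differentiableAt.hasDerivAt.cexp.deriv]
    ring
  have hEit : ∀ m, iteratedDeriv m E 0 = (taylorDeriv q b m : ℂ) := by
    intro m
    rcases m with _ | m
    · simp [hE, taylorDeriv, shiftSeries]
    · rw [hE, iteratedDeriv_const_sub (by positivity), iteratedDeriv_neg,
        iteratedDeriv_const_mul_field, iteratedDeriv_shiftSeries hb hρ']
      simp [taylorDeriv, shiftCoeff]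
      ring
  have hLit : ∀ m, iteratedDeriv m (deriv L) 0 = (((m + 1).factorial * (-q * a m) : ℝ) : ℂ) := by
    intro m
    rw [← iteratedDeriv_succ', hL, iteratedDeriv_const_mul_field, iteratedDeriv_shiftSeries ha hρ]
    simp [shiftCoeff]
    ring
  have key : iteratedDeriv (n + 1) E 0 = ∑ i ∈ Finset.range (n + 1),
      (n.choose i : ℂ) * iteratedDeriv i (deriv L) 0 * iteratedDeriv (n - i) E 0 := by
    rw [iteratedDeriv_succ', hderiv.iteratedDeriv_eq,
      iteratedDeriv_mul hLan.deriv.contDiffAt hEan.contDiffAt]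
  simp only [hEit, hLit] at key
  exact_mod_cast key

/-- Strong induction on the recursion. Convergence is coefficientwise, so no bound uniform in `n` is
needed. -/
theorem tendsto_of_exp_eq {q : ℝ} (hq : q ≠ 0) {a b : ℕ → ℕ → ℝ} {a' b' : ℕ → ℝ}
    (ha : ∀ n, ∃ C ρ : ℝ, 0 ≤ ρ ∧ ∀ k, |a n k| ≤ C * ρ ^ k)
    (hb : ∀ n, ∃ C ρ : ℝ, 0 ≤ ρ ∧ ∀ k, |b n k| ≤ C * ρ ^ k)
    (ha' : ∃ C ρ : ℝ, 0 ≤ ρ ∧ ∀ k, |a' k| ≤ C * ρ ^ k)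
    (hb' : ∃ C ρ : ℝ, 0 ≤ ρ ∧ ∀ k, |b' k| ≤ C * ρ ^ k)
    (h : ∀ n, ∀ᶠ z in 𝓝 (0 : ℂ),
      Complex.exp (-(q : ℂ) * shiftSeries (a n) z) = 1 - q * shiftSeries (b n) z)
    (h' : ∀ᶠ z in 𝓝 (0 : ℂ),
      Complex.exp (-(q : ℂ) * shiftSeries a' z) = 1 - q * shiftSeries b' z)
    (hlim : ∀ k, Tendsto (fun n => a n k) atTop (𝓝 (a' k))) (k : ℕ) :
    Tendsto (fun n => b n k) atTop (𝓝 (b' k)) := by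
  have key : ∀ m, Tendsto (fun n => taylorDeriv q (b n) m) atTop (𝓝 (taylorDeriv q b' m)) := by
    intro m
    induction m using Nat.strong_induction_on with
    | _ m ih =>
      rcases m with _ | m
      · simp [taylorDeriv]
      · obtain ⟨C, ρ, hρ, hC⟩ := ha'
        obtain ⟨D, σ, hσ, hD⟩ := hb'
        rw [taylorDeriv_succ_of_exp_eq hC hρ hD hσ h']
        have : ∀ n, taylorDeriv q (b n) (m + 1) = ∑ i ∈ Finset.range (m + 1),
            (m.choose i : ℝ) * ((i + 1).factorial * (-q * a n i)) *
              taylorDeriv q (b n) (m - i) := by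
          intro n
          obtain ⟨C, ρ, hρ, hC⟩ := ha n
          obtain ⟨D, σ, hσ, hD⟩ := hb n
          exact taylorDeriv_succ_of_exp_eq hC hρ hD hσ (h n) m
        simp only [this]
        refine tendsto_finsetSum _ fun i _ => Tendsto.mul ?_ (ih _ (by omega))
        exact (((hlim i).const_mul _).const_mul _).const_mul _
  have h1 := (key (k + 1)).const_mul (((k + 1).factorial * (-q) : ℝ)⁻¹)
  have hne : ((k + 1).factorial * (-q) : ℝ) ≠ 0 :=
    mul_ne_zero (by positivity) (neg_ne_zero.2 hq)
  have h2 : ∀ c : ℕ → ℝ, ((k + 1).factorial * (-q) : ℝ)⁻¹ * taylorDeriv q c (k + 1) = c k := by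
    intro c
    rw [taylorDeriv, ← mul_assoc _ (-q), inv_mul_cancel_left₀ hne]
  simpa only [h2] using h1

/-! ### The rational function with interlacing zeros and poles -/

/-- The rational function `∏ᵢ (x - βᵢ) / (x - αᵢ)`. -/
noncomputable def ratio {r : ℕ} (α β : Fin r → ℝ) (x : ℝ) : ℝ :=
  ∏ i, (x - β i) / (x - α i)

/-- The weights in the partial fraction decomposition of `ratio α β`. -/
noncomputable def ratioWeight {r : ℕ} (α β : Fin r → ℝ) (i : Fin r) : ℝ :=
  -(Lagrange.nodalWeight Finset.univ α i * ∏ j, (α i - β j))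

/-- The derivative of `ratio α β`. -/
noncomputable def ratioDeriv {r : ℕ} (α β : Fin r → ℝ) (x : ℝ) : ℝ :=
  ∑ i, ratioWeight α β i / (x - α i) ^ 2

theorem degree_nodal_sub_nodal_lt {r : ℕ} (v w : Fin r → ℝ) :
    (Lagrange.nodal Finset.univ v - Lagrange.nodal Finset.univ w).degree <
      (Finset.univ : Finset (Fin r)).card := by
  have h := Polynomial.degree_sub_lt_left (p := Lagrange.nodal Finset.univ v)
    (q := Lagrange.nodal Finset.univ w) (by simp [Lagrange.degree_nodal])
    Lagrange.nodal_ne_zero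
    (by rw [Lagrange.nodal_monic.leadingCoeff, Lagrange.nodal_monic.leadingCoeff])
  rwa [Lagrange.degree_nodal] at h

/-- The difference of two monic polynomials of degree `r` has smaller degree, so it equals its
Lagrange interpolant at the nodes `v`. -/
theorem prod_sub_sub_prod_sub {r : ℕ} {v w : Fin r → ℝ} (hv : Function.Injective v) {x : ℝ}
    (hx : ∀ i, x ≠ v i) :
    ∏ i, (x - v i) - ∏ i, (x - w i) = (∏ i, (x - v i)) *
      ∑ i, -(Lagrange.nodalWeight Finset.univ v i * ∏ j, (v i - w j)) / (x - v i) := by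
  have h := congrArg (Polynomial.eval x) (Lagrange.eq_interpolate hv.injOn
    (degree_nodal_sub_nodal_lt v w))
  rw [Lagrange.eval_interpolate_not_at_node _ fun i _ => hx i] at h
  simp only [Polynomial.eval_sub, Lagrange.eval_nodal] at h
  rw [h]
  congr 1
  refine Finset.sum_congr rfl fun i _ => ?_
  have : ∏ j, (v i - v j) = 0 := Finset.prod_eq_zero (Finset.mem_univ i) (sub_self _)
  rw [this]
  ring

namespace IsIntervalSystem

variable {r : ℕ} {α β : Fin r → ℝ} (h : IsIntervalSystem α β)
include h

theorem separated {i j : Fin r} (hij : j ≠ i) : β j < α i ∨ β i < α j :=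
  (lt_or_gt_of_ne hij).imp (h.2.1 j i) (h.2.1 i j)

theorem injective_left : Function.Injective α := by
  intro i j hij
  by_contra hne
  have h1 := h.1 i
  have h2 := h.1 j
  rcases h.separated hne with h3 | h3 <;> linarith

theorem mul_sub_pos {i j : Fin r} (hij : j ≠ i) {x y : ℝ} (hx : x ∈ Set.Icc (α i) (β i))
    (hy : y ∈ Set.Icc (α i) (β i)) : 0 < (x - β j) * (y - α j) := by
  have h2 := h.1 j
  rcases h.separated hij with h3 | h3
  · exact mul_pos (by linarith [hx.1]) (by linarith [hy.1])
  · exact mul_pos_of_neg_of_neg (by linarith [hx.2]) (by linarith [hy.2])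

/-- By interlacing, `αᵢ - βⱼ` and `αᵢ - αⱼ` have the same sign for `j ≠ i`; the remaining factor `αᵢ
- βᵢ < 0` cancels the minus sign. -/
theorem ratioWeight_pos (i : Fin r) : 0 < ratioWeight α β i := by
  have hi := h.1 i
  rw [ratioWeight, Lagrange.nodalWeight, ← Finset.mul_prod_erase _ _ (Finset.mem_univ i),
    mul_left_comm, ← Finset.prod_mul_distrib, ← neg_mul, neg_sub]
  refine mul_pos (by linarith) (Finset.prod_pos fun j hj => ?_)
  have := h.mul_sub_pos (Finset.ne_of_mem_erase hj) (Set.left_mem_Icc.2 hi.le)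
    (Set.left_mem_Icc.2 hi.le)
  rw [← div_eq_inv_mul]
  rcases pos_and_pos_or_neg_and_neg_of_mul_pos this with h1 | h1
  · exact div_pos h1.1 h1.2
  · exact div_pos_of_neg_of_neg h1.1 h1.2

theorem ratio_eq_one_sub_sum {x : ℝ} (hx : ∀ i, x ≠ α i) :
    ratio α β x = 1 - ∑ i, ratioWeight α β i / (x - α i) := by
  have h1 := prod_sub_sub_prod_sub (w := β) h.injective_left hx
  have h2 : ∏ i, (x - α i) ≠ 0 := Finset.prod_ne_zero_iff.2 fun i _ => sub_ne_zero.2 (hx i)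
  rw [ratio, Finset.prod_div_distrib, div_eq_iff h2]
  simp only [ratioWeight]
  linarith

theorem hasDerivAt_ratio {x : ℝ} (hx : ∀ i, x ≠ α i) :
    HasDerivAt (ratio α β) (ratioDeriv α β x) x := by
  have h1 : ∀ᶠ y in 𝓝 x, ∀ i, y ≠ α i :=
    eventually_all.2 fun i => isOpen_ne.mem_nhds (hx i)
  have h2 : HasDerivAt (fun y => 1 - ∑ i, ratioWeight α β i / (y - α i)) (ratioDeriv α β x) x := by
    have h3 : ∀ i ∈ Finset.univ, HasDerivAt (fun y => ratioWeight α β i / (y - α i))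
        (-(ratioWeight α β i / (x - α i) ^ 2)) x := by
      intro i _
      have := (hasDerivAt_const x (ratioWeight α β i)).div ((hasDerivAt_id x).sub_const (α i))
        (sub_ne_zero.2 (hx i))
      convert! this using 1
      simp
      ring
    have h4 := (HasDerivAt.fun_sum h3).const_sub 1
    convert! h4 using 1
    simp [ratioDeriv]
  exact h2.congr_of_eventuallyEq (h1.mono fun y hy => h.ratio_eq_one_sub_sum hy)

theorem ne_left_of_mem_Ioo {i : Fin r} {x : ℝ} (hx : x ∈ Set.Ioo (α i) (β i)) (j : Fin r) :
    x ≠ α j := by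
  rintro rfl
  rcases eq_or_ne j i with rfl | hj
  · exact lt_irrefl _ hx.1
  · have := h.mul_sub_pos hj (Set.Ioo_subset_Icc_self hx) (Set.Ioo_subset_Icc_self hx)
    simp at this

theorem ratioDeriv_pos {i : Fin r} {x : ℝ} (hx : x ∈ Set.Ioo (α i) (β i)) :
    0 < ratioDeriv α β x := by
  refine Finset.sum_pos (fun j _ => ?_) ⟨i, Finset.mem_univ i⟩
  have := sub_ne_zero.2 (h.ne_left_of_mem_Ioo hx j)
  have := h.ratioWeight_pos j
  positivity

theorem prod_mul_prod_neg {i : Fin r} {x y : ℝ} (hx : x ∈ Set.Icc (α i) (β i))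
    (hy : y ∈ Set.Icc (α i) (β i)) (hxβ : x < β i) (hyα : α i < y) :
    (∏ j, (x - β j)) * ∏ j, (y - α j) < 0 := by
  rw [← Finset.prod_mul_distrib, ← Finset.mul_prod_erase _ _ (Finset.mem_univ i)]
  exact mul_neg_of_neg_of_pos (mul_neg_of_neg_of_pos (by linarith) (by linarith))
    (Finset.prod_pos fun j hj => h.mul_sub_pos (Finset.ne_of_mem_erase hj) hx hy)

theorem ratio_neg {i : Fin r} {x : ℝ} (hx : x ∈ Set.Ioo (α i) (β i)) : ratio α β x < 0 := by
  have hx' := Set.Ioo_subset_Icc_self hx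
  have := h.prod_mul_prod_neg hx' hx' hx.2 hx.1
  rw [ratio, Finset.prod_div_distrib]
  exact (mul_neg_iff.1 this).elim (fun h1 => div_neg_of_pos_of_neg h1.1 h1.2)
    fun h1 => div_neg_of_neg_of_pos h1.1 h1.2

theorem strictMonoOn_ratio (i : Fin r) : StrictMonoOn (ratio α β) (Set.Ioo (α i) (β i)) := by
  refine strictMonoOn_of_deriv_pos (convex_Ioo _ _)
    (fun x hx => (h.hasDerivAt_ratio (h.ne_left_of_mem_Ioo hx)).continuousAt.continuousWithinAt)
    fun x hx => ?_
  rw [interior_Ioo] at hx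
  rw [(h.hasDerivAt_ratio (h.ne_left_of_mem_Ioo hx)).deriv]
  exact h.ratioDeriv_pos hx

theorem bijOn_ratio (i : Fin r) :
    Set.BijOn (ratio α β) (Set.Ioo (α i) (β i)) (Set.Iio 0) := by
  refine ⟨fun x hx => h.ratio_neg hx, (h.strictMonoOn_ratio i).injOn, fun y hy => ?_⟩
  have hi := h.1 i
  have hy : y < 0 := hy
  -- Clearing denominators avoids the pole at `αᵢ`. The constant factor `∏ⱼ (βᵢ - αⱼ)` fixes the
  -- sign: the value at `αᵢ` is negative, and at `βᵢ` it is `-y` times a square.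
  set Q : ℝ → ℝ := fun x => (∏ j, (x - β j) - y * ∏ j, (x - α j)) * ∏ j, (β i - α j) with hQ
  have hQc : Continuous Q := by fun_prop
  have hα := Set.left_mem_Icc.2 hi.le
  have hβ := Set.right_mem_Icc.2 hi.le
  have hAα : ∏ j, (α i - α j) = 0 := Finset.prod_eq_zero (Finset.mem_univ i) (sub_self _)
  have hBβ : ∏ j, (β i - β j) = 0 := Finset.prod_eq_zero (Finset.mem_univ i) (sub_self _)
  have hlt := h.prod_mul_prod_neg hα hβ hi hi
  have h1 : Q (α i) < 0 := by simpa [hQ, hAα] using hlt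
  have h2 : 0 < Q (β i) := by
    have : ∏ j, (β i - α j) ≠ 0 := by rintro h0; simp [h0] at hlt
    simp only [hQ, hBβ, zero_sub, neg_mul, mul_assoc]
    have := mul_self_pos.2 this
    nlinarith
  obtain ⟨x, hx, hx0⟩ := intermediate_value_Ioo hi.le hQc.continuousOn ⟨h1, h2⟩
  refine ⟨x, hx, ?_⟩
  have h3 : ∏ j, (β i - α j) ≠ 0 := by rintro h0; simp [h0] at hlt
  have h4 : ∏ j, (x - α j) ≠ 0 :=
    Finset.prod_ne_zero_iff.2 fun j _ => sub_ne_zero.2 (h.ne_left_of_mem_Ioo hx j)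
  have h5 := (mul_eq_zero.1 hx0).resolve_right h3
  rw [ratio, Finset.prod_div_distrib, div_eq_iff h4]
  linarith

/-- Partial fractions in `w`: the right side vanishes at infinity, where `R = 1`, and its poles are
the simple roots `xᵢ` of `R = y`, with residues `1 / R'(xᵢ)`. -/
theorem sum_inv_ratioDeriv {y : ℝ} (hy : y < 0) {x : Fin r → ℝ}
    (hx : ∀ i, x i ∈ Set.Ioo (α i) (β i)) (hxy : ∀ i, ratio α β (x i) = y) {w : ℝ}
    (hw : ∀ i, β i < w) :
    ∑ i, 1 / ((w - x i) * ratioDeriv α β (x i)) = 1 / (ratio α β w - y) - 1 / (1 - y) := by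
  have hinj : Function.Injective x := by
    intro i j hij
    by_contra hne
    have h1 := hx i
    have h2 := hx j
    rw [hij] at h1
    rcases h.separated hne with h3 | h3 <;> linarith [h1.1, h1.2, h2.1, h2.2]
  have hy1 : 1 - y ≠ 0 := by linarith
  have hwx : ∀ i, w ≠ x i := fun i => ((hx i).2.trans (hw i)).ne'
  have hwα : ∀ i, 0 < w - α i := fun i => by linarith [h.1 i, hw i]
  -- the polynomial with roots `x i`
  set A := Lagrange.nodal Finset.univ α with hA
  set B := Lagrange.nodal Finset.univ β with hB
  set D := Lagrange.nodal Finset.univ x with hD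
  have hAB : ∀ t, (∀ i, t ≠ α i) → B.eval t = ratio α β t * A.eval t := by
    intro t ht
    rw [hA, hB, Lagrange.eval_nodal, Lagrange.eval_nodal, ratio, Finset.prod_div_distrib,
      div_mul_cancel₀]
    exact Finset.prod_ne_zero_iff.2 fun i _ => sub_ne_zero.2 (ht i)
  have hxα : ∀ i j, x i ≠ α j := fun i => h.ne_left_of_mem_Ioo (hx i)
  -- A combination of differences of monic polynomials has degree less than `r`, yet it vanishes at
  -- the `r` distinct points `xᵢ`. Hence `B - y A = (1 - y) D`.
  have hBD : B - D - Polynomial.C y * (A - D) = 0 := by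
    refine Polynomial.eq_zero_of_degree_lt_of_eval_index_eq_zero (v := x) (s := Finset.univ)
      hinj.injOn ?_ fun i _ => ?_
    · refine (Polynomial.degree_sub_le _ _).trans_lt (max_lt (degree_nodal_sub_nodal_lt _ _) ?_)
      rw [Polynomial.degree_C_mul hy.ne]
      exact degree_nodal_sub_nodal_lt _ _
    · have : D.eval (x i) = 0 := Lagrange.eval_nodal_at_node (Finset.mem_univ i)
      simp [this, hAB _ (hxα i), hxy]
  have hP : B - Polynomial.C y * A = Polynomial.C (1 - y) * D := by
    rw [Polynomial.C_sub, Polynomial.C_1]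
    linear_combination hBD
  -- Differentiate `B - y A = (1 - y) D` and `B = R A` at `xᵢ`, where `R = y`.
  have hder : ∀ i, (1 - y) * D.derivative.eval (x i) = ratioDeriv α β (x i) * A.eval (x i) := by
    intro i
    have h1 := congrArg (fun p => (Polynomial.derivative p).eval (x i)) hP
    simp only [Polynomial.derivative_sub, Polynomial.derivative_C_mul, Polynomial.eval_sub,
      Polynomial.eval_mul, Polynomial.eval_C] at h1
    have h2 : HasDerivAt (fun t => ratio α β t * A.eval t)
        (ratioDeriv α β (x i) * A.eval (x i) + ratio α β (x i) * A.derivative.eval (x i)) (x i) :=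
      (h.hasDerivAt_ratio (hxα i)).mul (A.hasDerivAt (x i))
    have h3 : (fun t => ratio α β t * A.eval t) =ᶠ[𝓝 (x i)] fun t => B.eval t := by
      have : ∀ᶠ t in 𝓝 (x i), ∀ j, t ≠ α j :=
        eventually_all.2 fun j => isOpen_ne.mem_nhds (hxα i j)
      exact this.mono fun t ht => (hAB t ht).symm
    have h4 := (h2.congr_of_eventuallyEq h3.symm).unique (B.hasDerivAt (x i))
    rw [hxy] at h4
    linarith
  have hAx : ∀ i, A.eval (x i) ≠ 0 := fun i => by
    rw [hA, Lagrange.eval_nodal]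
    exact Finset.prod_ne_zero_iff.2 fun j _ => sub_ne_zero.2 (hxα i j)
  have hlag := congrArg (Polynomial.eval w) (Lagrange.eq_interpolate hinj.injOn
    (degree_nodal_sub_nodal_lt α β))
  rw [Lagrange.eval_interpolate_not_at_node _ fun i _ => hwx i] at hlag
  have hterm : ∀ i, Lagrange.nodalWeight Finset.univ x i * (w - x i)⁻¹ *
      (A - B).eval (x i) = (1 - y) ^ 2 * (1 / ((w - x i) * ratioDeriv α β (x i))) := by
    intro i
    have h1 := hder i
    have h2 := hAx i
    have h3 := (h.ratioDeriv_pos (hx i)).ne'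
    have h4 := sub_ne_zero.2 (hwx i)
    have h5 : D.derivative.eval (x i) = ratioDeriv α β (x i) * A.eval (x i) / (1 - y) := by
      rw [eq_div_iff hy1, ← h1]; ring
    rw [Lagrange.nodalWeight_eq_eval_derivative_nodal (Finset.mem_univ i), ← hD, h5,
      Polynomial.eval_sub, hAB _ (hxα i), hxy]
    field_simp
  simp only [← hA, ← hB, ← hD] at hlag
  rw [Finset.sum_congr rfl fun i _ => hterm i, ← Finset.mul_sum] at hlag
  have hPw := congrArg (Polynomial.eval w) hP
  have hw' : ∀ i, w ≠ α i := fun i => (sub_pos.1 (hwα i)).ne'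
  simp only [Polynomial.eval_sub, Polynomial.eval_mul, Polynomial.eval_C, hAB w hw'] at hPw hlag
  have hR : 0 < ratio α β w := Finset.prod_pos fun i _ =>
    div_pos (sub_pos.2 (hw i)) (hwα i)
  have hAw : A.eval w ≠ 0 := by
    rw [hA, Lagrange.eval_nodal]
    exact Finset.prod_ne_zero_iff.2 fun j _ => (hwα j).ne'
  have hRy : ratio α β w - y ≠ 0 := by linarith
  set S := ∑ i, 1 / ((w - x i) * ratioDeriv α β (x i)) with hS
  have h6 : D.eval w = (ratio α β w - y) * A.eval w / (1 - y) := by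
    rw [eq_div_iff hy1]; linarith
  rw [h6] at hlag
  have h7 : A.eval w * ((1 - ratio α β w) - (ratio α β w - y) * (1 - y) * S) = 0 := by
    have : (ratio α β w - y) * A.eval w / (1 - y) * ((1 - y) ^ 2 * S)
      = (ratio α β w - y) * A.eval w * (1 - y) * S := by field_simp
    rw [this] at hlag
    linarith
  have h8 := (mul_eq_zero.1 h7).resolve_left hAw
  field_simp
  linarith

end IsIntervalSystem

/-! ### Beta integrals on the half-line -/

theorem lintegral_rpow_mul_exp_neg_mul_Ioi {a r : ℝ} (ha : 0 < a) (hr : 0 < r) :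
    ∫⁻ t in Set.Ioi (0 : ℝ), ENNReal.ofReal (t ^ (a - 1) * Real.exp (-(r * t))) =
      ENNReal.ofReal ((1 / r) ^ a * Real.Gamma a) := by
  have h := Real.integral_rpow_mul_exp_neg_mul_Ioi ha hr
  have hpos : 0 < (1 / r) ^ a * Real.Gamma a :=
    mul_pos (by positivity) (Real.Gamma_pos_of_pos ha)
  -- A Bochner integral defaults to zero when the function is not integrable, so a nonzero value
  -- proves integrability.
  have hint : IntegrableOn (fun t : ℝ => t ^ (a - 1) * Real.exp (-(r * t))) (Set.Ioi 0) :=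
    .of_integral_ne_zero (by rw [h]; exact hpos.ne')
  rw [← h, ofReal_integral_eq_lintegral_ofReal hint]
  refine (ae_restrict_mem measurableSet_Ioi).mono fun t ht => ?_
  have : 0 < t := ht
  positivity

/-- Write `1 / (ρ + s)` as the integral of `exp (-(ρ + s) t)` over `t > 0`, exchange by Tonelli, and
apply the reflection formula to `Γ(p) Γ(1 - p)`. -/
theorem lintegral_rpow_div_add_Ioi {p ρ : ℝ} (hp0 : 0 < p) (hp1 : p < 1) (hρ : 0 < ρ) :
    ∫⁻ s in Set.Ioi (0 : ℝ), ENNReal.ofReal (s ^ (p - 1) / (ρ + s)) =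
      ENNReal.ofReal (ρ ^ (p - 1) * (Real.pi / Real.sin (Real.pi * p))) := by
  have h1 : ∀ s ∈ Set.Ioi (0 : ℝ), ENNReal.ofReal (s ^ (p - 1) / (ρ + s)) =
      ∫⁻ t in Set.Ioi (0 : ℝ),
        ENNReal.ofReal (s ^ (p - 1)) * ENNReal.ofReal (Real.exp (-((ρ + s) * t))) := by
    intro s hs
    have hs : 0 < s := hs
    have h2 := lintegral_rpow_mul_exp_neg_mul_Ioi one_pos (add_pos hρ hs)
    simp only [sub_self, Real.rpow_zero, one_mul, Real.rpow_one, Real.Gamma_one, mul_one] at h2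
    rw [lintegral_const_mul _ (by fun_prop), h2, ← ENNReal.ofReal_mul (by positivity),
      mul_one_div]
  rw [setLIntegral_congr_fun measurableSet_Ioi h1,
    lintegral_lintegral_swap (by fun_prop)]
  have h3 : ∀ t ∈ Set.Ioi (0 : ℝ), ∫⁻ s in Set.Ioi (0 : ℝ),
        ENNReal.ofReal (s ^ (p - 1)) * ENNReal.ofReal (Real.exp (-((ρ + s) * t))) =
      ENNReal.ofReal (Real.Gamma p) *
        ENNReal.ofReal (t ^ ((1 - p) - 1) * Real.exp (-(ρ * t))) := by
    intro t ht
    have ht : 0 < t := ht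
    have h4 : ∀ s ∈ Set.Ioi (0 : ℝ),
        ENNReal.ofReal (s ^ (p - 1)) * ENNReal.ofReal (Real.exp (-((ρ + s) * t))) =
        ENNReal.ofReal (Real.exp (-(ρ * t))) *
          ENNReal.ofReal (s ^ (p - 1) * Real.exp (-(t * s))) := by
      intro s hs
      have hs : 0 < s := hs
      rw [← ENNReal.ofReal_mul (by positivity), ← ENNReal.ofReal_mul (by positivity),
        mul_left_comm, ← Real.exp_add]
      ring_nf
    rw [setLIntegral_congr_fun measurableSet_Ioi h4, lintegral_const_mul _ (by fun_prop),
      lintegral_rpow_mul_exp_neg_mul_Ioi hp0 ht, ← ENNReal.ofReal_mul (by positivity),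
      ← ENNReal.ofReal_mul (Real.Gamma_pos_of_pos hp0).le]
    congr 1
    have : (1 / t) ^ p = t ^ (1 - p - 1) := by
      rw [one_div, Real.inv_rpow ht.le, ← Real.rpow_neg ht.le]; ring_nf
    rw [this]
    ring
  rw [setLIntegral_congr_fun measurableSet_Ioi h3, lintegral_const_mul _ (by fun_prop),
    lintegral_rpow_mul_exp_neg_mul_Ioi (by linarith) hρ,
    ← ENNReal.ofReal_mul (Real.Gamma_pos_of_pos hp0).le, mul_left_comm,
    Real.Gamma_mul_Gamma_one_sub]
  congr 2
  rw [one_div, Real.inv_rpow hρ.le, ← Real.rpow_neg hρ.le]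
  ring_nf

theorem integrableOn_rpow_div_add_Ioi {p ρ : ℝ} (hp0 : 0 < p) (hp1 : p < 1) (hρ : 0 < ρ) :
    IntegrableOn (fun s : ℝ => s ^ (p - 1) / (ρ + s)) (Set.Ioi 0) := by
  refine (lintegral_ofReal_ne_top_iff_integrable (Measurable.aestronglyMeasurable
    (by fun_prop)) ?_).1 ?_
  · refine (ae_restrict_mem measurableSet_Ioi).mono fun t ht => ?_
    have : 0 < t := ht
    simp only [Pi.zero_apply]
    positivity
  · rw [lintegral_rpow_div_add_Ioi hp0 hp1 hρ]
    exact ENNReal.ofReal_ne_top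

theorem integral_rpow_div_add_Ioi {p ρ : ℝ} (hp0 : 0 < p) (hp1 : p < 1) (hρ : 0 < ρ) :
    ∫ s in Set.Ioi (0 : ℝ), s ^ (p - 1) / (ρ + s) =
      ρ ^ (p - 1) * (Real.pi / Real.sin (Real.pi * p)) := by
  rw [integral_eq_lintegral_of_nonneg_ae, lintegral_rpow_div_add_Ioi hp0 hp1 hρ,
    ENNReal.toReal_ofReal]
  · have : 0 < Real.sin (Real.pi * p) := Real.sin_pos_of_pos_of_lt_pi (by positivity)
      (by nlinarith [Real.pi_pos])
    positivity
  · refine (ae_restrict_mem measurableSet_Ioi).mono fun t ht => ?_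
    have : 0 < t := ht
    simp only [Pi.zero_apply]
    positivity
  · exact Measurable.aestronglyMeasurable (by fun_prop)

/-- For `q < 0` both terms are integrable, with `p = q + 1`. For `q > 0` each diverges, and `s / (ρ
+ s) = 1 - ρ / (ρ + s)` reduces the difference to the case `p = q`. -/
theorem integral_rpow_mul_sub_Ioi {q : ℝ} (hq : q ∈ Set.Ioo (-1 : ℝ) 0 ∪ Set.Ioo (0 : ℝ) 1)
    {ρ : ℝ} (hρ : 0 < ρ) :
    IntegrableOn (fun s : ℝ => s ^ q * (1 / (ρ + s) - 1 / (1 + s))) (Set.Ioi 0) ∧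
    ∫ s in Set.Ioi (0 : ℝ), s ^ q * (1 / (ρ + s) - 1 / (1 + s)) =
      Real.pi / Real.sin (Real.pi * q) * (1 - ρ ^ q) := by
  rcases hq with hq | hq
  · have hp0 : 0 < q + 1 := by linarith [hq.1]
    have hp1 : q + 1 < 1 := by linarith [hq.2]
    have h1 := integrableOn_rpow_div_add_Ioi hp0 hp1 hρ
    have h2 := integrableOn_rpow_div_add_Ioi hp0 hp1 one_pos
    have h3 : ∀ s ∈ Set.Ioi (0 : ℝ), s ^ q * (1 / (ρ + s) - 1 / (1 + s)) =
        s ^ (q + 1 - 1) / (ρ + s) - s ^ (q + 1 - 1) / (1 + s) := by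
      intro s _
      rw [add_sub_cancel_right]; ring
    refine ⟨(h1.sub h2).congr_fun (fun s hs => (h3 s hs).symm) measurableSet_Ioi, ?_⟩
    rw [setIntegral_congr_fun measurableSet_Ioi h3, integral_sub h1 h2,
      integral_rpow_div_add_Ioi hp0 hp1 hρ, integral_rpow_div_add_Ioi hp0 hp1 one_pos,
      mul_add, mul_one, Real.sin_add_pi, Real.one_rpow, add_sub_cancel_right, div_neg]
    ring
  · have h1 := (integrableOn_rpow_div_add_Ioi hq.1 hq.2 hρ).const_mul ρ
    have h2 := integrableOn_rpow_div_add_Ioi hq.1 hq.2 one_pos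
    have h3 : ∀ s ∈ Set.Ioi (0 : ℝ), s ^ q * (1 / (ρ + s) - 1 / (1 + s)) =
        s ^ (q - 1) / (1 + s) - ρ * (s ^ (q - 1) / (ρ + s)) := by
      intro s hs
      have hs : 0 < s := hs
      rw [Real.rpow_sub_one hs.ne']
      field_simp
      ring
    refine ⟨(h2.sub h1).congr_fun (fun s hs => (h3 s hs).symm) measurableSet_Ioi, ?_⟩
    rw [setIntegral_congr_fun measurableSet_Ioi h3, integral_sub h2 h1, integral_const_mul,
      integral_rpow_div_add_Ioi hq.1 hq.2 hρ, integral_rpow_div_add_Ioi hq.1 hq.2 one_pos,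
      Real.one_rpow, Real.rpow_sub_one hρ.ne']
    field_simp

theorem lintegral_rpow_mul_sub_Ioi {q : ℝ} (hq : q ∈ Set.Ioo (-1 : ℝ) 0 ∪ Set.Ioo (0 : ℝ) 1)
    {ρ : ℝ} (hρ : 0 < ρ) (hρ1 : ρ ≤ 1) :
    ∫⁻ s in Set.Ioi (0 : ℝ), ENNReal.ofReal (s ^ q * (1 / (ρ + s) - 1 / (1 + s))) =
      ENNReal.ofReal (Real.pi / Real.sin (Real.pi * q) * (1 - ρ ^ q)) := by
  obtain ⟨h1, h2⟩ := integral_rpow_mul_sub_Ioi hq hρ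
  rw [← h2, ofReal_integral_eq_lintegral_ofReal h1]
  refine (ae_restrict_mem measurableSet_Ioi).mono fun s hs => ?_
  have hs : 0 < s := hs
  have : 1 / (1 + s) ≤ 1 / (ρ + s) := by gcongr
  exact mul_nonneg (by positivity) (by linarith)

/-! ### Change of variables along the branches of the inverse -/

namespace IsIntervalSystem

variable {r : ℕ} {α β : Fin r → ℝ} (h : IsIntervalSystem α β)
include h

theorem ratio_pos_of_lt {w : ℝ} (hw : ∀ i, β i < w) : 0 < ratio α β w :=
  Finset.prod_pos fun i _ => div_pos (by linarith [hw i]) (by linarith [h.1 i, hw i])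

theorem ratio_le_one_of_lt {w : ℝ} (hw : ∀ i, β i < w) : ratio α β w ≤ 1 :=
  Finset.prod_le_one (fun i _ => (div_pos (by linarith [hw i]) (by linarith [h.1 i, hw i])).le)
    fun i _ => (div_le_one (by linarith [h.1 i, hw i])).2 (by linarith [h.1 i])

/-- Substitute `s = -R(x)` on each interval; all images are `(0, ∞)`, so the branches add up under
one integral, by the partial fraction identity at `y = -s`. -/
theorem sum_lintegral_abs_ratio_rpow_div {q : ℝ}
    (hq : q ∈ Set.Ioo (-1 : ℝ) 0 ∪ Set.Ioo (0 : ℝ) 1) {w : ℝ} (hw : ∀ i, β i < w) :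
    ∑ i, ∫⁻ x in Set.Ioo (α i) (β i), ENNReal.ofReal (|ratio α β x| ^ q / (w - x)) =
      ENNReal.ofReal (Real.pi / Real.sin (Real.pi * q) * (1 - ratio α β w ^ q)) := by
  set X : Fin r → ℝ → ℝ := fun i s =>
    Function.invFunOn (ratio α β) (Set.Ioo (α i) (β i)) (-s) with hX
  have hneg : ∀ s ∈ Set.Ioi (0 : ℝ), -s ∈ Set.Iio (0 : ℝ) := fun s hs =>
    neg_lt_zero.2 (Set.mem_Ioi.1 hs)
  have hXmem : ∀ i, ∀ s ∈ Set.Ioi (0 : ℝ), X i s ∈ Set.Ioo (α i) (β i) := fun i s hs =>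
    Function.invFunOn_mem ((h.bijOn_ratio i).surjOn (hneg s hs))
  have hXeq : ∀ i, ∀ s ∈ Set.Ioi (0 : ℝ), ratio α β (X i s) = -s := fun i s hs =>
    Function.invFunOn_eq ((h.bijOn_ratio i).surjOn (hneg s hs))
  have hXinv : ∀ i, ∀ x ∈ Set.Ioo (α i) (β i), X i (-ratio α β x) = x := by
    intro i x hx
    have h0 : 0 < -ratio α β x := neg_pos.2 (h.ratio_neg hx)
    refine (h.bijOn_ratio i).injOn (hXmem i _ h0) hx ?_
    rw [hXeq i _ h0, neg_neg]
  set g : Fin r → ℝ → ENNReal := fun i s =>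
    ENNReal.ofReal (s ^ q * (1 / ((w - X i s) * ratioDeriv α β (X i s)))) with hg
  have himage : ∀ i, (fun x => -ratio α β x) '' Set.Ioo (α i) (β i) = Set.Ioi 0 := by
    intro i
    ext s
    constructor
    · rintro ⟨x, hx, rfl⟩
      exact neg_pos.2 (h.ratio_neg hx)
    · intro hs
      exact ⟨X i s, hXmem i s hs, by simp [hXeq i s hs]⟩
  have hterm : ∀ i, ∫⁻ x in Set.Ioo (α i) (β i), ENNReal.ofReal (|ratio α β x| ^ q / (w - x)) =
      ∫⁻ s in Set.Ioi (0 : ℝ), g i s := by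
    intro i
    have hcv := lintegral_image_eq_lintegral_abs_deriv_mul (f := fun x => -ratio α β x)
      (f' := fun x => -ratioDeriv α β x) measurableSet_Ioo
      (fun x hx => (h.hasDerivAt_ratio (h.ne_left_of_mem_Ioo hx)).neg.hasDerivWithinAt)
      (fun x hx y hy hxy => (h.bijOn_ratio i).injOn hx hy (neg_injective hxy)) (g i)
    rw [himage] at hcv
    rw [hcv]
    refine setLIntegral_congr_fun measurableSet_Ioo fun x hx => ?_
    have h1 := h.ratioDeriv_pos hx
    have h2 : 0 < w - x := by linarith [hx.2, hw i]
    simp only [hg, hXinv i x hx]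
    rw [← ENNReal.ofReal_mul (abs_nonneg _), abs_neg, abs_of_pos h1,
      abs_of_neg (h.ratio_neg hx)]
    congr 1
    field_simp
  -- The inverse branches are antitone, which gives their measurability.
  have hmeas : ∀ i, AEMeasurable (g i) (volume.restrict (Set.Ioi 0)) := by
    intro i
    have h1 : AntitoneOn (X i) (Set.Ioi 0) := by
      intro s hs t ht hst
      by_contra hlt
      have := (h.strictMonoOn_ratio i) (hXmem i s hs) (hXmem i t ht) (not_le.1 hlt)
      rw [hXeq i s hs, hXeq i t ht] at this
      linarith
    have h2 := aemeasurable_restrict_of_antitoneOn (μ := volume) measurableSet_Ioi h1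
    have h3 : Measurable (ratioDeriv α β) := by
      unfold ratioDeriv
      fun_prop
    have h4 := h3.comp_aemeasurable h2
    have h5 : AEMeasurable (fun s : ℝ => s ^ q) (volume.restrict (Set.Ioi 0)) :=
      Measurable.aemeasurable (by fun_prop)
    exact (h5.mul (((h2.const_sub w).mul h4).const_div 1)).ennreal_ofReal
  rw [Finset.sum_congr rfl fun i _ => hterm i, ← lintegral_finsetSum' _ fun i _ => hmeas i,
    ← lintegral_rpow_mul_sub_Ioi hq (h.ratio_pos_of_lt hw) (h.ratio_le_one_of_lt hw)]
  refine setLIntegral_congr_fun measurableSet_Ioi fun s hs => ?_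
  have hs0 : 0 < s := hs
  have hsum := h.sum_inv_ratioDeriv (neg_lt_zero.2 hs0) (fun i => hXmem i s hs)
    (fun i => hXeq i s hs) hw
  rw [sub_neg_eq_add, sub_neg_eq_add] at hsum
  simp only [hg]
  rw [← hsum, Finset.mul_sum, ENNReal.ofReal_sum_of_nonneg]
  intro i _
  have h1 := h.ratioDeriv_pos (hXmem i s hs)
  have h2 : 0 < w - X i s := by linarith [(hXmem i s hs).2, hw i]
  positivity

end IsIntervalSystem

/-! ### Moment series of measures with bounded support -/

section Moments

variable {ν : Measure ℝ} [IsFiniteMeasure ν] {ρ : ℝ}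

theorem abs_integral_pow_le (h : ∀ᵐ t ∂ν, |t| ≤ ρ) (k : ℕ) :
    |∫ t, t ^ k ∂ν| ≤ ν.real Set.univ * ρ ^ k := by
  rw [mul_comm, ← Real.norm_eq_abs]
  refine norm_integral_le_of_norm_le_const (h.mono fun t ht => ?_)
  rw [norm_pow, Real.norm_eq_abs]
  gcongr

theorem integrable_pow (h : ∀ᵐ t ∂ν, |t| ≤ ρ) (k : ℕ) : Integrable (fun t => t ^ k) ν := by
  refine Integrable.of_bound (Measurable.aestronglyMeasurable (by fun_prop)) (ρ ^ k)
    (h.mono fun t ht => ?_)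
  rw [norm_pow, Real.norm_eq_abs]
  gcongr

theorem hasSum_integral_pow_mul (h : ∀ᵐ t ∂ν, |t| ≤ ρ) (hρ : 0 ≤ ρ) {z : ℝ}
    (hz : ρ * |z| < 1) :
    HasSum (fun k : ℕ => (∫ t, t ^ k ∂ν) * z ^ (k + 1)) (∫ t, z / (1 - t * z) ∂ν) := by
  have hgeo := summable_geometric_of_lt_one (by positivity) hz
  have key : HasSum (fun k : ℕ => ∫ t, t ^ k * z ^ (k + 1) ∂ν) (∫ t, z / (1 - t * z) ∂ν) := by
    refine hasSum_integral_of_dominated_convergence (fun k _ => |z| * (ρ * |z|) ^ k)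
      (fun k => Measurable.aestronglyMeasurable (by fun_prop)) (fun k => h.mono fun t ht => ?_)
      (.of_forall fun t => hgeo.mul_left _) (integrable_const _) (h.mono fun t ht => ?_)
    · rw [norm_mul, norm_pow, norm_pow, Real.norm_eq_abs, Real.norm_eq_abs, pow_succ, mul_pow]
      calc |t| ^ k * (|z| ^ k * |z|) ≤ ρ ^ k * (|z| ^ k * |z|) := by gcongr
        _ = _ := by ring
    · have h1 : |t * z| < 1 := by
        rw [abs_mul]
        exact (mul_le_mul_of_nonneg_right ht (abs_nonneg z)).trans_lt hz
      have h2 := (hasSum_geometric_of_abs_lt_one h1).mul_left z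
      rw [div_eq_mul_inv]
      convert! h2 using 2
      ring
  simpa only [integral_mul_const] using key

end Moments

theorem shiftSeries_ofReal {a : ℕ → ℝ} {z s : ℝ}
    (h : HasSum (fun k : ℕ => a k * z ^ (k + 1)) s) : shiftSeries a (z : ℂ) = (s : ℂ) := by
  have h1 := Complex.hasSum_ofReal.2 h
  rw [shiftSeries, ← h1.tsum_eq]
  simp

/-- Both sides are analytic at zero, and the positive reals accumulate there, so the identity
theorem applies. -/
theorem eventually_exp_eq_of_real {q : ℝ} {a b : ℕ → ℝ} {C ρ C' ρ' : ℝ}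
    (ha : ∀ k, |a k| ≤ C * ρ ^ k) (hρ : 0 ≤ ρ) (hb : ∀ k, |b k| ≤ C' * ρ' ^ k) (hρ' : 0 ≤ ρ')
    (h : ∀ᶠ z : ℝ in 𝓝[>] 0,
      Complex.exp (-(q : ℂ) * shiftSeries a (z : ℂ)) = 1 - q * shiftSeries b (z : ℂ)) :
    ∀ᶠ z in 𝓝 (0 : ℂ),
      Complex.exp (-(q : ℂ) * shiftSeries a z) = 1 - q * shiftSeries b z := by
  have hA := (hasFPowerSeriesAt_shiftSeries ha hρ).analyticAt
  have hB := (hasFPowerSeriesAt_shiftSeries hb hρ').analyticAt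
  refine (AnalyticAt.frequently_eq_iff_eventually_eq (analyticAt_const.mul hA).cexp
    (analyticAt_const.sub (analyticAt_const.mul hB))).1 ?_
  have ht : Tendsto (fun z : ℝ => (z : ℂ)) (𝓝[>] 0) (𝓝[≠] 0) := by
    refine tendsto_nhdsWithin_of_tendsto_nhds_of_eventually_within _ ?_ ?_
    · exact (Complex.continuous_ofReal.tendsto' 0 0 (by simp)).mono_left nhdsWithin_le_nhds
    · filter_upwards [self_mem_nhdsWithin] with z hz
      simpa using (ne_of_gt hz : z ≠ 0)
  exact ht.frequently h.frequently

/-! ### The Stieltjes transform of the interval density -/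

theorem sin_div_pos {q : ℝ} (hq : q ∈ Set.Ioo (-1 : ℝ) 0 ∪ Set.Ioo (0 : ℝ) 1) :
    0 < Real.sin (Real.pi * q) / (Real.pi * q) := by
  have hpi := Real.pi_pos
  rcases hq with hq | hq
  · refine div_pos_of_neg_of_neg (Real.sin_neg_of_neg_of_neg_pi_lt ?_ ?_) ?_ <;>
      nlinarith [hq.1, hq.2]
  · refine div_pos (Real.sin_pos_of_pos_of_lt_pi ?_ ?_) ?_ <;> nlinarith [hq.1, hq.2]

theorem measurableSet_iUnion_Icc {r : ℕ} (α β : Fin r → ℝ) :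
    MeasurableSet (⋃ i, Set.Icc (α i) (β i)) :=
  MeasurableSet.iUnion fun _ => measurableSet_Icc

theorem measurable_intervalDensity (q : ℝ) {r : ℕ} (α β : Fin r → ℝ) :
    Measurable (intervalDensity q α β) := by
  refine Measurable.indicator ?_ (measurableSet_iUnion_Icc α β)
  have : Measurable fun x : ℝ => ∏ i, (|x - α i| ^ (-q) * |x - β i| ^ q) :=
    Finset.measurable_fun_prod _ fun i _ => by fun_prop
  exact this.const_mul _

theorem prod_rpow_eq_abs_ratio_rpow (q : ℝ) {r : ℕ} (α β : Fin r → ℝ) (x : ℝ) :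
    ∏ j, (|x - α j| ^ (-q) * |x - β j| ^ q) = |ratio α β x| ^ q := by
  rw [ratio, Finset.abs_prod, ← Real.finsetProd_rpow _ _ fun j _ => abs_nonneg _]
  refine Finset.prod_congr rfl fun j _ => ?_
  rw [abs_div, Real.div_rpow (abs_nonneg _) (abs_nonneg _), Real.rpow_neg (abs_nonneg _)]
  ring

theorem ae_mem_intervalMeasure (q : ℝ) {r : ℕ} (α β : Fin r → ℝ) :
    ∀ᵐ t ∂(intervalMeasure q α β), t ∈ ⋃ i, Set.Icc (α i) (β i) := by
  rw [intervalMeasure, ae_withDensity_iff (measurable_intervalDensity q α β).ennreal_ofReal]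
  refine .of_forall fun t ht => ?_
  by_contra hmem
  simp [intervalDensity, hmem] at ht

namespace IsIntervalSystem

variable {r : ℕ} {α β : Fin r → ℝ} (h : IsIntervalSystem α β)
include h

theorem pairwise_disjoint : Pairwise (Function.onFun Disjoint fun i => Set.Icc (α i) (β i)) := by
  intro i j hij
  rw [Function.onFun, Set.disjoint_left]
  intro x hx hy
  rcases h.separated hij with h1 | h1
  · linarith [hx.2, hy.1]
  · linarith [hx.1, hy.2]

/-- The density is `sin (π q) / (π q) * |R| ^ q` on the intervals, and its constant turns the factor
`π / sin (π q)` of the Beta integral into `1 / q`. -/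
theorem lintegral_inv_sub_intervalMeasure {q : ℝ}
    (hq : q ∈ Set.Ioo (-1 : ℝ) 0 ∪ Set.Ioo (0 : ℝ) 1) {w : ℝ} (hw : ∀ i, β i < w) :
    ∫⁻ t, ENNReal.ofReal (1 / (w - t)) ∂(intervalMeasure q α β) =
      ENNReal.ofReal ((1 - ratio α β w ^ q) / q) := by
  have hc := sin_div_pos hq
  set c := Real.sin (Real.pi * q) / (Real.pi * q) with hcdef
  rw [intervalMeasure, lintegral_withDensity_eq_lintegral_mul _
    (measurable_intervalDensity q α β).ennreal_ofReal (by fun_prop)]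
  have h1 : ((fun x => ENNReal.ofReal (intervalDensity q α β x)) *
      fun t => ENNReal.ofReal (1 / (w - t))) = (⋃ i, Set.Icc (α i) (β i)).indicator fun x =>
        ENNReal.ofReal (c * ∏ i, (|x - α i| ^ (-q) * |x - β i| ^ q)) *
          ENNReal.ofReal (1 / (w - x)) := by
    ext x
    by_cases hx : x ∈ ⋃ i, Set.Icc (α i) (β i)
    · simp [intervalDensity, hx, hcdef]
    · simp [intervalDensity, hx]
  rw [h1, lintegral_indicator (measurableSet_iUnion_Icc α β),
    lintegral_iUnion (fun _ => measurableSet_Icc) h.pairwise_disjoint, tsum_fintype]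
  have h2 : ∀ i, ∫⁻ x in Set.Icc (α i) (β i),
      ENNReal.ofReal (c * ∏ i, (|x - α i| ^ (-q) * |x - β i| ^ q)) *
        ENNReal.ofReal (1 / (w - x)) =
      ENNReal.ofReal c *
        ∫⁻ x in Set.Ioo (α i) (β i), ENNReal.ofReal (|ratio α β x| ^ q / (w - x)) := by
    intro i
    rw [← setLIntegral_congr Ioo_ae_eq_Icc, ← lintegral_const_mul' _ _ ENNReal.ofReal_ne_top]
    refine setLIntegral_congr_fun measurableSet_Ioo fun x hx => ?_
    rw [prod_rpow_eq_abs_ratio_rpow, ← ENNReal.ofReal_mul (by positivity), ← ENNReal.ofReal_mul hc.le]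
    ring_nf
  rw [Finset.sum_congr rfl fun i _ => h2 i, ← Finset.mul_sum,
    h.sum_lintegral_abs_ratio_rpow_div hq hw, ← ENNReal.ofReal_mul hc.le]
  congr 1
  have hs : Real.sin (Real.pi * q) ≠ 0 := fun h0 => by simp [hcdef, h0] at hc
  have hq0 : q ≠ 0 := fun h0 => by simp [hcdef, h0] at hc
  have := Real.pi_pos.ne'
  rw [hcdef]
  field_simp

variable {ρ : ℝ} (hαρ : ∀ i, -ρ ≤ α i) (hβρ : ∀ i, β i ≤ ρ)
include hαρ hβρ

omit h in
theorem abs_le_of_mem {t : ℝ} (ht : t ∈ ⋃ i, Set.Icc (α i) (β i)) : |t| ≤ ρ := by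
  obtain ⟨i, hi⟩ := Set.mem_iUnion.1 ht
  exact abs_le.2 ⟨(hαρ i).trans hi.1, hi.2.trans (hβρ i)⟩

omit h in
theorem ae_abs_le_intervalMeasure (q : ℝ) : ∀ᵐ t ∂(intervalMeasure q α β), |t| ≤ ρ :=
  (ae_mem_intervalMeasure q α β).mono fun _ ht => abs_le_of_mem hαρ hβρ ht

theorem radius_pos : 0 < ρ := by
  -- Without intervals the total length would be zero, not one.
  rcases Nat.eq_zero_or_pos r with rfl | hr
  · have := h.2.2
    simp at this
  · have := h.1 ⟨0, hr⟩
    linarith [hαρ ⟨0, hr⟩, hβρ ⟨0, hr⟩]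

/-- At `w = ρ + 1` the kernel `1 / (w - t)` is at least `1 / (2ρ + 1)` on the support, so the finite
Stieltjes transform bounds the mass; no local analysis of the endpoint singularities is needed. -/
theorem isFiniteMeasure_intervalMeasure {q : ℝ}
    (hq : q ∈ Set.Ioo (-1 : ℝ) 0 ∪ Set.Ioo (0 : ℝ) 1) :
    IsFiniteMeasure (intervalMeasure q α β) := by
  have hρ := h.radius_pos hαρ hβρ
  have h1 := h.lintegral_inv_sub_intervalMeasure hq (w := ρ + 1) fun i => by linarith [hβρ i]
  constructor
  calc intervalMeasure q α β Set.univ = ∫⁻ _, 1 ∂(intervalMeasure q α β) := by simp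
    _ ≤ ∫⁻ t, ENNReal.ofReal (2 * ρ + 1) * ENNReal.ofReal (1 / (ρ + 1 - t))
        ∂(intervalMeasure q α β) := by
      refine lintegral_mono_ae ((ae_abs_le_intervalMeasure hαρ hβρ q).mono fun t ht => ?_)
      have := abs_le.1 ht
      rw [← ENNReal.ofReal_mul (by positivity), ENNReal.one_le_ofReal, mul_one_div,
        one_le_div (by linarith)]
      linarith
    _ < ⊤ := by
      rw [lintegral_const_mul _ (by fun_prop), h1]
      exact ENNReal.mul_lt_top ENNReal.ofReal_lt_top ENNReal.ofReal_lt_top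

theorem integral_inv_sub_intervalMeasure {q : ℝ}
    (hq : q ∈ Set.Ioo (-1 : ℝ) 0 ∪ Set.Ioo (0 : ℝ) 1) {w : ℝ} (hw : ρ < w) :
    ∫ t, 1 / (w - t) ∂(intervalMeasure q α β) = (1 - ratio α β w ^ q) / q := by
  have hw' : ∀ i, β i < w := fun i => (hβρ i).trans_lt hw
  have h0 := h.ratio_pos_of_lt hw'
  have h1 := h.ratio_le_one_of_lt hw'
  rw [integral_eq_lintegral_of_nonneg_ae, h.lintegral_inv_sub_intervalMeasure hq hw',
    ENNReal.toReal_ofReal]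
  · rcases hq with hq | hq
    · exact div_nonneg_of_nonpos
        (by linarith [Real.one_le_rpow_of_pos_of_le_one_of_nonpos h0 h1 hq.2.le]) hq.2.le
    · exact div_nonneg (by linarith [Real.rpow_le_one h0.le h1 hq.1.le]) hq.1.le
  · refine (ae_abs_le_intervalMeasure hαρ hβρ q).mono fun t ht => ?_
    have := abs_le.1 ht
    exact one_div_nonneg.2 (by linarith)
  · exact Measurable.aestronglyMeasurable (by fun_prop)

end IsIntervalSystem

/-! ### The uniform measure on the intervals and its Markov-Krein image -/

/-- Lebesgue measure on the union of the intervals `[αᵢ, βᵢ]`. -/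
noncomputable def unionMeasure {r : ℕ} (α β : Fin r → ℝ) : Measure ℝ :=
  volume.restrict (⋃ i, Set.Icc (α i) (β i))

theorem ae_mem_unionMeasure {r : ℕ} (α β : Fin r → ℝ) :
    ∀ᵐ t ∂(unionMeasure α β), t ∈ ⋃ i, Set.Icc (α i) (β i) :=
  ae_restrict_mem (measurableSet_iUnion_Icc α β)

theorem isCompact_support_of_ae_mem {ν : Measure ℝ} {K : Set ℝ} (hK : IsCompact K)
    (h : ∀ᵐ t ∂ν, t ∈ K) : IsCompact ν.support :=
  hK.of_isClosed_subset Measure.isClosed_support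
    (Measure.support_subset_of_isClosed hK.isClosed h)

namespace IsIntervalSystem

variable {r : ℕ} {α β : Fin r → ℝ} (h : IsIntervalSystem α β)
include h

theorem integral_unionMeasure {g : ℝ → ℝ} (hg : Continuous g) :
    ∫ t, g t ∂(unionMeasure α β) = ∑ i, ∫ t in (α i)..(β i), g t := by
  rw [unionMeasure, integral_iUnion_fintype (fun _ => measurableSet_Icc) h.pairwise_disjoint
    fun i => hg.continuousOn.integrableOn_compact isCompact_Icc]
  refine Finset.sum_congr rfl fun i _ => ?_
  rw [integral_Icc_eq_integral_Ioc, intervalIntegral.integral_of_le (h.1 i).le]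

theorem integral_pow_unionMeasure (k : ℕ) :
    ∫ t, t ^ k ∂(unionMeasure α β) = ∑ i, (β i ^ (k + 1) - α i ^ (k + 1)) / (k + 1) := by
  rw [h.integral_unionMeasure (continuous_pow k)]
  exact Finset.sum_congr rfl fun i _ => by rw [integral_pow]

theorem isProbabilityMeasure_unionMeasure : IsProbabilityMeasure (unionMeasure α β) := by
  constructor
  rw [unionMeasure, Measure.restrict_apply_univ,
    measure_iUnion h.pairwise_disjoint (fun _ => measurableSet_Icc), tsum_fintype]
  simp only [Real.volume_Icc]
  rw [← ENNReal.ofReal_sum_of_nonneg fun i _ => by linarith [h.1 i], h.2.2, ENNReal.ofReal_one]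

theorem unionMeasure_mem_boundedDensity {c : ℝ} (hc : 1 ≤ c) :
    (⟨unionMeasure α β, h.isProbabilityMeasure_unionMeasure⟩ : ProbabilityMeasure ℝ) ∈
      BoundedDensity c := by
  have hS := measurableSet_iUnion_Icc α β
  refine ⟨isCompact_support_of_ae_mem (isCompact_iUnion fun _ => isCompact_Icc)
    (ae_mem_unionMeasure α β), (⋃ i, Set.Icc (α i) (β i)).indicator 1,
    measurable_one.indicator hS, fun x => ⟨Set.indicator_nonneg (fun _ _ => zero_le_one) x,
      (Set.indicator_le_self' (fun _ _ => zero_le_one) x).trans hc⟩, ?_⟩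
  have : (fun x => ENNReal.ofReal ((⋃ i, Set.Icc (α i) (β i)).indicator 1 x)) =
      (⋃ i, Set.Icc (α i) (β i)).indicator (1 : ℝ → ENNReal) := by
    ext x
    by_cases hx : x ∈ ⋃ i, Set.Icc (α i) (β i) <;> simp [hx]
  rw [this, withDensity_indicator_one hS]
  rfl

variable {ρ : ℝ} (hαρ : ∀ i, -ρ ≤ α i) (hβρ : ∀ i, β i ≤ ρ)
include hαρ hβρ

omit h in
theorem ae_abs_le_unionMeasure : ∀ᵐ t ∂(unionMeasure α β), |t| ≤ ρ :=
  (ae_mem_unionMeasure α β).mono fun _ ht => abs_le_of_mem hαρ hβρ ht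

theorem hasSum_unionMeasure {z : ℝ} (hz0 : 0 < z) (hz : ρ * z < 1) :
    HasSum (fun k : ℕ => (∫ t, t ^ k ∂(unionMeasure α β)) * z ^ (k + 1))
      (∑ i, (Real.log (1 - α i * z) - Real.log (1 - β i * z))) := by
  have hlog : ∀ x : ℝ, |x| ≤ ρ → HasSum (fun k : ℕ => (x * z) ^ (k + 1) / (k + 1 : ℝ))
      (-Real.log (1 - x * z)) := by
    intro x hx
    refine Real.hasSum_pow_div_log_of_abs_lt_one ?_
    rw [abs_mul, abs_of_pos hz0]
    exact (mul_le_mul_of_nonneg_right hx hz0.le).trans_lt hz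
  have hsum := hasSum_sum (s := Finset.univ) fun i (_ : i ∈ Finset.univ) =>
    (hlog (β i) (abs_le.2 ⟨by linarith [hαρ i, h.1 i], hβρ i⟩)).sub
      (hlog (α i) (abs_le.2 ⟨hαρ i, by linarith [hβρ i, h.1 i]⟩))
  convert! hsum using 1
  · ext k
    rw [h.integral_pow_unionMeasure, Finset.sum_mul]
    refine Finset.sum_congr rfl fun i _ => ?_
    rw [mul_pow, mul_pow]
    ring
  · exact Finset.sum_congr rfl fun i _ => by ring

omit hαρ in
theorem exp_sum_log_eq_ratio_rpow (q : ℝ) {z : ℝ} (hz0 : 0 < z) (hz : ρ * z < 1) :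
    Real.exp (-q * ∑ i, (Real.log (1 - α i * z) - Real.log (1 - β i * z))) =
      ratio α β (1 / z) ^ q := by
  have hα : ∀ i, 0 < 1 - α i * z := fun i => by nlinarith [h.1 i, hβρ i]
  have hβ : ∀ i, 0 < 1 - β i * z := fun i => by nlinarith [hβρ i]
  have hr : ratio α β (1 / z) = ∏ i, (1 - β i * z) / (1 - α i * z) := by
    refine Finset.prod_congr rfl fun i _ => ?_
    have h1 : 1 / z - β i = (1 - β i * z) / z := by field_simp
    have h2 : 1 / z - α i = (1 - α i * z) / z := by field_simp
    rw [h1, h2, div_div_div_cancel_right₀ hz0.ne']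
  have hpos : 0 < ∏ i, (1 - β i * z) / (1 - α i * z) :=
    Finset.prod_pos fun i _ => div_pos (hβ i) (hα i)
  rw [hr, Real.rpow_def_of_pos hpos, Real.log_prod fun i _ => (div_pos (hβ i) (hα i)).ne',
    Finset.sum_congr rfl fun i _ => Real.log_div (hβ i).ne' (hα i).ne']
  congr 1
  rw [neg_mul_comm, mul_comm, ← Finset.sum_neg_distrib]
  congr 1
  exact Finset.sum_congr rfl fun i _ => by ring

/-- For real `0 < z < 1/ρ` both sides equal `R(1/z) ^ q`. -/
theorem eventually_exp_shiftSeries_eq {q : ℝ}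
    (hq : q ∈ Set.Ioo (-1 : ℝ) 0 ∪ Set.Ioo (0 : ℝ) 1) :
    ∀ᶠ z in 𝓝 (0 : ℂ),
      Complex.exp (-(q : ℂ) * shiftSeries (fun k => ∫ t, t ^ k ∂(unionMeasure α β)) z) =
        1 - q * shiftSeries (fun k => ∫ t, t ^ k ∂(intervalMeasure q α β)) z := by
  have hρ := h.radius_pos hαρ hβρ
  have := h.isProbabilityMeasure_unionMeasure
  have := h.isFiniteMeasure_intervalMeasure hαρ hβρ hq
  have hq0 : q ≠ 0 := by
    rcases hq with hq | hq
    · exact hq.2.ne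
    · exact hq.1.ne'
  refine eventually_exp_eq_of_real (abs_integral_pow_le (ae_abs_le_unionMeasure hαρ hβρ)) hρ.le
    (abs_integral_pow_le (ae_abs_le_intervalMeasure hαρ hβρ q)) hρ.le ?_
  filter_upwards [Ioo_mem_nhdsGT (inv_pos.2 hρ)] with z hz
  have hz0 : 0 < z := hz.1
  have hz1 : ρ * z < 1 := by
    have := mul_lt_mul_of_pos_left hz.2 hρ
    rwa [mul_inv_cancel₀ hρ.ne'] at this
  have hν := hasSum_integral_pow_mul (ae_abs_le_intervalMeasure hαρ hβρ q) hρ.le (z := z)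
    (by rwa [abs_of_pos hz0])
  rw [shiftSeries_ofReal (h.hasSum_unionMeasure hαρ hβρ hz0 hz1), shiftSeries_ofReal hν]
  have hw : ρ < 1 / z := by rwa [lt_div_iff₀ hz0]
  have h1 : ∀ t : ℝ, z / (1 - t * z) = 1 / (1 / z - t) := fun t => by
    have h3 : 1 / z - t = (1 - t * z) / z := by field_simp
    rw [h3, one_div_div]
  simp only [h1]
  rw [h.integral_inv_sub_intervalMeasure hαρ hβρ hq hw,
    ← h.exp_sum_log_eq_ratio_rpow hβρ q hz0 hz1]
  have key : ∀ x : ℝ, x = 1 - q * ((1 - x) / q) := fun x => by field_simp; ring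
  exact_mod_cast key _

theorem isProbabilityMeasure_intervalMeasure_of_bound {q : ℝ}
    (hq : q ∈ Set.Ioo (-1 : ℝ) 0 ∪ Set.Ioo (0 : ℝ) 1) :
    IsProbabilityMeasure (intervalMeasure q α β) := by
  have hρ := h.radius_pos hαρ hβρ
  have := h.isProbabilityMeasure_unionMeasure
  have := h.isFiniteMeasure_intervalMeasure hαρ hβρ hq
  have hq0 : q ≠ 0 := by
    rcases hq with hq | hq
    · exact hq.2.ne
    · exact hq.1.ne'
  -- The recursion at `n = 0` compares the coefficients of `z`, so the two total masses coincide.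
  have key := taylorDeriv_succ_of_exp_eq
    (abs_integral_pow_le (ae_abs_le_unionMeasure hαρ hβρ)) hρ.le
    (abs_integral_pow_le (ae_abs_le_intervalMeasure hαρ hβρ q)) hρ.le
    (h.eventually_exp_shiftSeries_eq hαρ hβρ hq) 0
  simp only [taylorDeriv, pow_zero, integral_const, smul_eq_mul, mul_one, zero_add,
    Finset.sum_range_one, Nat.choose_self, Nat.factorial_one, Nat.cast_one, one_mul,
    probReal_univ, neg_mul, neg_inj, Nat.sub_zero] at key
  have h1 : (intervalMeasure q α β).real Set.univ = 1 := by
    have : q * (intervalMeasure q α β).real Set.univ = q * 1 := by rw [key, mul_one]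
    exact mul_left_cancel₀ hq0 this
  constructor
  rw [← ENNReal.toReal_eq_one_iff]
  exact h1

omit hαρ hβρ

omit h in
theorem exists_bound (α β : Fin r → ℝ) : ∃ ρ, (∀ i, -ρ ≤ α i) ∧ ∀ i, β i ≤ ρ := by
  obtain ⟨a, ha⟩ := (Set.finite_range α).bddBelow
  obtain ⟨b, hb⟩ := (Set.finite_range β).bddAbove
  refine ⟨max (-a) b, fun i => ?_, fun i => ?_⟩
  · have := ha ⟨i, rfl⟩
    linarith [le_max_left (-a) b]
  · exact (hb ⟨i, rfl⟩).trans (le_max_right _ _)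

theorem isProbabilityMeasure_intervalMeasure {q : ℝ}
    (hq : q ∈ Set.Ioo (-1 : ℝ) 0 ∪ Set.Ioo (0 : ℝ) 1) :
    IsProbabilityMeasure (intervalMeasure q α β) := by
  obtain ⟨ρ, h1, h2⟩ := exists_bound α β
  exact h.isProbabilityMeasure_intervalMeasure_of_bound h1 h2 hq

end IsIntervalSystem

theorem intervalFamily_subset_markovKreinImage {q : ℝ}
    (hq : q ∈ Set.Ioo (-1 : ℝ) 0 ∪ Set.Ioo (0 : ℝ) 1) :
    intervalFamily q ⊆ markovKreinImage q (BoundedDensity 1) := by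
  rintro ν ⟨r, α, β, h, hν⟩
  obtain ⟨ρ, h1, h2⟩ := IsIntervalSystem.exists_bound α β
  have hq1 : 1 ≤ 1 / |q| := by
    rcases hq with hq | hq
    · rw [abs_of_neg hq.2]
      exact (one_le_div (by linarith [hq.2])).2 (by linarith [hq.1])
    · rw [abs_of_pos hq.1]
      exact (one_le_div hq.1).2 hq.2.le
  refine ⟨⟨unionMeasure α β, h.isProbabilityMeasure_unionMeasure⟩,
    h.unionMeasure_mem_boundedDensity le_rfl, h.unionMeasure_mem_boundedDensity hq1, ?_, ?_⟩
  · rw [hν]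
    exact isCompact_support_of_ae_mem (isCompact_iUnion fun _ => isCompact_Icc)
      (ae_mem_intervalMeasure q α β)
  · have := h.eventually_exp_shiftSeries_eq h1 h2 hq
    rw [← hν] at this
    exact this

/-! ### Weak convergence from moments on a common compact set -/

theorem tendsto_of_tendsto_integral_pow {u : ℕ → ProbabilityMeasure ℝ} {ν : ProbabilityMeasure ℝ}
    {ρ : ℝ} (hu : ∀ n, ∀ᵐ t ∂(u n : Measure ℝ), |t| ≤ ρ) (hν : ∀ᵐ t ∂(ν : Measure ℝ), |t| ≤ ρ)
    (h : ∀ k : ℕ, Tendsto (fun n => ∫ t : ℝ, t ^ k ∂(u n : Measure ℝ)) atTop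
      (𝓝 (∫ t : ℝ, t ^ k ∂(ν : Measure ℝ)))) :
    Tendsto u atTop (𝓝 ν) := by
  rw [ProbabilityMeasure.tendsto_iff_forall_integral_tendsto]
  intro g
  have hpoly : ∀ p : Polynomial ℝ, Tendsto (fun n => ∫ t, p.eval t ∂(u n : Measure ℝ)) atTop
      (𝓝 (∫ t, p.eval t ∂(ν : Measure ℝ))) := by
    intro p
    have hint : ∀ m : ProbabilityMeasure ℝ, (∀ᵐ t ∂(m : Measure ℝ), |t| ≤ ρ) →
        ∫ t, p.eval t ∂(m : Measure ℝ) =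
          ∑ i ∈ Finset.range (p.natDegree + 1), p.coeff i * ∫ t, t ^ i ∂(m : Measure ℝ) := by
      intro m hm
      simp only [Polynomial.eval_eq_sum_range]
      rw [integral_finsetSum _ fun i _ => (integrable_pow hm i).const_mul _]
      exact Finset.sum_congr rfl fun i _ => integral_const_mul _ _
    rw [hint ν hν]
    simp only [hint _ (hu _)]
    exact tendsto_finsetSum _ fun i _ => (h i).const_mul _
  have hdist : ∀ (p : Polynomial ℝ) (ε : ℝ), (∀ t ∈ Set.Icc (-ρ) ρ, |p.eval t - g t| < ε) →
      ∀ m : ProbabilityMeasure ℝ, (∀ᵐ t ∂(m : Measure ℝ), |t| ≤ ρ) →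
        |∫ t, p.eval t ∂(m : Measure ℝ) - ∫ t, g t ∂(m : Measure ℝ)| ≤ ε := by
    intro p ε hp m hm
    have hpi : Integrable (fun t => p.eval t) (m : Measure ℝ) := by
      simp only [Polynomial.eval_eq_sum_range]
      exact integrable_finsetSum _ fun i _ => (integrable_pow hm i).const_mul _
    rw [← integral_sub hpi (g.integrable _), ← Real.norm_eq_abs]
    have := norm_integral_le_of_norm_le_const (μ := (m : Measure ℝ)) (C := ε)
      (f := fun t => p.eval t - g t) (hm.mono fun t ht => (hp t (abs_le.1 ht)).le)
    simpa using this
  rw [Metric.tendsto_atTop]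
  intro ε hε
  -- Weierstrass approximation on `[-ρ, ρ]`, which carries all the measures.
  obtain ⟨p, hp⟩ := exists_polynomial_near_of_continuousOn (-ρ) ρ g g.continuous.continuousOn
    (ε / 4) (by positivity)
  obtain ⟨N, hN⟩ := Metric.tendsto_atTop.1 (hpoly p) (ε / 4) (by positivity)
  refine ⟨N, fun n hn => ?_⟩
  have h1 := abs_le.1 (hdist p _ hp (u n) (hu n))
  have h2 := abs_le.1 (hdist p _ hp ν hν)
  have h3 := abs_lt.1 (hN n hn)
  rw [Real.dist_eq, abs_lt]
  constructor <;> linarith [h1.1, h1.2, h2.1, h2.2, h3.1, h3.2]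

theorem exists_ae_abs_le {ν : Measure ℝ} (h : IsCompact ν.support) :
    ∃ ρ : ℝ, 1 ≤ ρ ∧ ∀ᵐ t ∂ν, |t| ≤ ρ := by
  obtain ⟨ρ, hρ⟩ := h.isBounded.exists_norm_le
  exact ⟨max ρ 1, le_max_right _ _, Filter.mem_of_superset Measure.support_mem_ae
    fun t ht => (hρ t ht).trans (le_max_left _ _)⟩

/-! ### Approximating a density at most one by unions of intervals -/

/-- The partition of `[-M, M]` into `n + 1` cells of equal length. -/
noncomputable def cellPoint (M : ℝ) (n j : ℕ) : ℝ := -M + j * (2 * M / (n + 1))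

/-- The mass that the density `f` puts on a cell, mixed with a uniform mass. -/
noncomputable def cellMass (f : ℝ → ℝ) (M : ℝ) (n j : ℕ) : ℝ :=
  (1 - 1 / (n + 1)) * (∫ t in (cellPoint M n j)..(cellPoint M n (j + 1)), f t) +
    1 / (n + 1) * (1 / (n + 1))

/-- The left endpoints of the intervals that approximate `f`. -/
noncomputable def cellLeft (M : ℝ) (n : ℕ) (j : Fin (n + 1)) : ℝ :=
  (1 + 1 / (n + 1)) * cellPoint M n j

/-- The right endpoints of the intervals that approximate `f`. -/
noncomputable def cellRight (f : ℝ → ℝ) (M : ℝ) (n : ℕ) (j : Fin (n + 1)) : ℝ :=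
  cellLeft M n j + cellMass f M n j

theorem abs_pow_sub_pow_le_mul (k : ℕ) {ρ s t : ℝ} (hs : |s| ≤ ρ) (ht : |t| ≤ ρ) :
    |s ^ k - t ^ k| ≤ (k * ρ ^ (k - 1)) * |s - t| := by
  refine (abs_pow_sub_pow_le s t k).trans ?_
  rw [mul_assoc, mul_comm]
  gcongr
  exact max_le hs ht

section Cells

variable {f : ℝ → ℝ} {M : ℝ} (hf : Measurable f) (hf0 : ∀ x, 0 ≤ f x) (hf1 : ∀ x, f x ≤ 1)
  (hM : 1 ≤ M) (hint : ∫ t in (-M)..M, f t = 1) (n : ℕ)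

theorem cellPoint_succ (j : ℕ) :
    cellPoint M n (j + 1) = cellPoint M n j + 2 * M / (n + 1) := by
  simp only [cellPoint]
  push_cast
  ring

theorem cellPoint_zero : cellPoint M n 0 = -M := by simp [cellPoint]

theorem cellPoint_last : cellPoint M n (n + 1) = M := by
  have : (n : ℝ) + 1 ≠ 0 := by positivity
  simp only [cellPoint]
  push_cast
  field_simp
  ring

include hM in
theorem monotone_cellPoint : Monotone (cellPoint M n) := by
  refine monotone_nat_of_le_succ fun j => ?_
  rw [cellPoint_succ]
  have : 0 ≤ 2 * M / ((n : ℝ) + 1) := by positivity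
  linarith

include hM in
theorem abs_cellPoint_le {j : ℕ} (hj : j ≤ n + 1) : |cellPoint M n j| ≤ M := by
  have h1 := monotone_cellPoint hM n (Nat.zero_le j)
  have h2 := monotone_cellPoint hM n hj
  rw [cellPoint_zero] at h1
  rw [cellPoint_last] at h2
  exact abs_le.2 ⟨h1, h2⟩

include hf hf0 hf1

theorem intervalIntegrable_mul_of_le_one {g : ℝ → ℝ} (hg : Continuous g) (a b : ℝ) :
    IntervalIntegrable (fun t => f t * g t) volume a b := by
  have h1 : IntervalIntegrable g volume a b := hg.intervalIntegrable a b
  rw [intervalIntegrable_iff] at h1 ⊢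
  refine h1.bdd_mul (c := 1) hf.aestronglyMeasurable (.of_forall fun t => ?_)
  rw [Real.norm_eq_abs, abs_of_nonneg (hf0 t)]
  exact hf1 t

theorem intervalIntegrable_of_le_one (a b : ℝ) : IntervalIntegrable f volume a b := by
  simpa using intervalIntegrable_mul_of_le_one hf hf0 hf1 continuous_one a b

include hM

theorem integral_cell_mem (j : ℕ) :
    (∫ t in (cellPoint M n j)..(cellPoint M n (j + 1)), f t) ∈ Set.Icc 0 (2 * M / (n + 1)) := by
  have hle := monotone_cellPoint hM n (Nat.le_succ j)
  refine ⟨intervalIntegral.integral_nonneg hle fun t _ => hf0 t, ?_⟩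
  have := intervalIntegral.integral_mono_on hle
    (intervalIntegrable_of_le_one hf hf0 hf1 _ _)
    (_root_.intervalIntegrable_const (μ := volume) (c := (1 : ℝ))) fun t _ => hf1 t
  rw [intervalIntegral.integral_const, smul_eq_mul, mul_one] at this
  rw [Nat.succ_eq_add_one, cellPoint_succ] at *
  linarith

theorem cellMass_mem (j : ℕ) : cellMass f M n j ∈ Set.Ioc 0 (2 * M / (n + 1)) := by
  obtain ⟨h1, h2⟩ := integral_cell_mem hf hf0 hf1 hM n j
  have hn : (1 : ℝ) ≤ n + 1 := by simp
  have h3 : (1 : ℝ) / (n + 1) ≤ 1 := (div_le_one (by positivity)).2 hn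
  have h4 : (0 : ℝ) < 1 / (n + 1) := by positivity
  have h5 : (1 : ℝ) / (n + 1) ≤ 2 * M / (n + 1) := by gcongr; linarith
  rw [cellMass]
  set m := ∫ t in (cellPoint M n j)..(cellPoint M n (j + 1)), f t
  set e := (1 : ℝ) / (n + 1)
  set l := 2 * M / ((n : ℝ) + 1)
  constructor
  · have := mul_nonneg (sub_nonneg.2 h3) h1
    positivity
  · nlinarith [mul_le_mul_of_nonneg_left h2 (sub_nonneg.2 h3),
      mul_le_mul_of_nonneg_left h5 h4.le]

omit hM in
theorem sum_integral_cell_mul {g : ℝ → ℝ} (hg : Continuous g) :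
    ∑ j ∈ Finset.range (n + 1),
      (∫ t in (cellPoint M n j)..(cellPoint M n (j + 1)), f t * g t) =
        ∫ t in (-M)..M, f t * g t := by
  rw [intervalIntegral.sum_integral_adjacent_intervals fun j _ =>
    intervalIntegrable_mul_of_le_one hf hf0 hf1 hg _ _, cellPoint_zero, cellPoint_last]

include hint

omit hM in
theorem sum_integral_cell :
    ∑ j ∈ Finset.range (n + 1),
      (∫ t in (cellPoint M n j)..(cellPoint M n (j + 1)), f t) = 1 := by
  have := sum_integral_cell_mul (M := M) hf hf0 hf1 n continuous_one
  simpa [hint] using this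

omit hM in
theorem sum_cellMass : ∑ j ∈ Finset.range (n + 1), cellMass f M n j = 1 := by
  have hn : (n : ℝ) + 1 ≠ 0 := by positivity
  simp only [cellMass, Finset.sum_add_distrib, ← Finset.mul_sum]
  rw [sum_integral_cell hf hf0 hf1 hint, Finset.sum_const, Finset.card_range, nsmul_eq_mul]
  push_cast
  field_simp
  ring

/-- Since `f ≤ 1` and `M ≥ 1`, the mass of a cell is at most its length. The uniform share keeps
every interval nondegenerate where `f` vanishes, and the dilation by `1 + 1 / (n + 1)` opens gaps
between neighbours. -/
theorem isIntervalSystem_cell : IsIntervalSystem (cellLeft M n) (cellRight f M n) := by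
  refine ⟨fun i => ?_, fun i j hij => ?_, ?_⟩
  · have := (cellMass_mem hf hf0 hf1 hM n i).1
    simp only [cellRight]
    linarith
  · have h1 := (cellMass_mem hf hf0 hf1 hM n i).2
    have h2 := monotone_cellPoint hM n (Nat.succ_le_of_lt (Fin.lt_def.1 hij))
    rw [Nat.succ_eq_add_one, cellPoint_succ] at h2
    have h4 : (0 : ℝ) < 1 / (n + 1) := by positivity
    have h5 : 0 < 2 * M / ((n : ℝ) + 1) := by positivity
    simp only [cellRight, cellLeft]
    nlinarith [mul_le_mul_of_nonneg_left h2 h4.le, mul_pos h4 h5]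
  · simp only [cellRight, add_sub_cancel_left]
    rw [← sum_cellMass (M := M) hf hf0 hf1 hint n, Finset.sum_range]

omit hint in
theorem cell_bounds (j : Fin (n + 1)) :
    -(2 * M) ≤ cellLeft M n j ∧ cellRight f M n j ≤ 2 * M := by
  have h1 := (cellMass_mem hf hf0 hf1 hM n j).2
  have h2 := (abs_le.1 (abs_cellPoint_le hM n j.2.le)).1
  have h3 := (abs_le.1 (abs_cellPoint_le hM n (Nat.succ_le_of_lt j.2))).2
  rw [Nat.succ_eq_add_one, cellPoint_succ] at h3
  have h4 : (0 : ℝ) < 1 / (n + 1) := by positivity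
  have h6 : (1 : ℝ) / (n + 1) ≤ 1 := (div_le_one (by positivity)).2 (by simp)
  have h5 : 0 < 2 * M / ((n : ℝ) + 1) := by positivity
  simp only [cellRight, cellLeft]
  constructor
  · nlinarith [mul_le_mul_of_nonneg_left h2 h4.le]
  · nlinarith [mul_le_mul_of_nonneg_left h3 h4.le, mul_pos h4 h5]

omit hint in
theorem abs_integral_cell_sub_le (k j : ℕ) (hj : j < n + 1) :
    |(∫ t in (cellPoint M n j)..(cellPoint M n (j + 1)), f t * t ^ k) -
      (∫ t in (cellPoint M n j)..(cellPoint M n (j + 1)), f t) * cellPoint M n j ^ k| ≤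
    (∫ t in (cellPoint M n j)..(cellPoint M n (j + 1)), f t) *
      ((k * (2 * M) ^ (k - 1)) * (2 * M / (n + 1))) := by
  have hle := monotone_cellPoint hM n (Nat.le_succ j)
  have hf' := intervalIntegrable_of_le_one hf hf0 hf1
  have ha := abs_le.1 (abs_cellPoint_le hM n hj.le)
  have hb := abs_le.1 (abs_cellPoint_le hM n (Nat.succ_le_of_lt hj))
  rw [← intervalIntegral.integral_mul_const, ← intervalIntegral.integral_sub
    (intervalIntegrable_mul_of_le_one hf hf0 hf1 (continuous_pow k) _ _) ((hf' _ _).mul_const _),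
    ← intervalIntegral.integral_mul_const, ← Real.norm_eq_abs]
  refine intervalIntegral.norm_integral_le_of_norm_le hle (.of_forall fun t ht => ?_)
    ((hf' _ _).mul_const _)
  rw [← mul_sub, norm_mul, Real.norm_eq_abs, Real.norm_eq_abs, abs_of_nonneg (hf0 t)]
  refine mul_le_mul_of_nonneg_left ((abs_pow_sub_pow_le_mul k (ρ := 2 * M) ?_ ?_).trans ?_) (hf0 t)
  · exact abs_le.2 ⟨by linarith [ht.1, ha.1], by linarith [ht.2, hb.2]⟩
  · exact abs_le.2 ⟨by linarith [ha.1], by linarith [ha.2]⟩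
  · gcongr
    have := ht.2
    rw [cellPoint_succ] at this
    exact abs_le.2 ⟨by linarith [ht.1, show 0 ≤ 2 * M / ((n : ℝ) + 1) by positivity],
      by linarith⟩

omit hint in
theorem abs_integral_interval_sub_le (k : ℕ) (j : Fin (n + 1)) :
    |(∫ t in (cellLeft M n j)..(cellRight f M n j), t ^ k) -
      cellMass f M n j * cellPoint M n j ^ k| ≤
    cellMass f M n j * ((k * (2 * M) ^ (k - 1)) * (3 * M / (n + 1))) := by
  have hm := cellMass_mem hf hf0 hf1 hM n j
  have hb := cell_bounds hf hf0 hf1 hM n j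
  have ha := abs_cellPoint_le hM n j.2.le
  have hle : cellLeft M n j ≤ cellRight f M n j := by
    simp only [cellRight]; linarith [hm.1]
  have hlen : cellRight f M n j - cellLeft M n j = cellMass f M n j := by simp [cellRight]
  have h1 : cellMass f M n j * cellPoint M n j ^ k =
      ∫ _ in (cellLeft M n j)..(cellRight f M n j), cellPoint M n j ^ k := by
    rw [intervalIntegral.integral_const, hlen, smul_eq_mul]
  rw [h1, ← intervalIntegral.integral_sub ((continuous_pow k).intervalIntegrable _ _)
    _root_.intervalIntegrable_const, ← Real.norm_eq_abs]
  refine (intervalIntegral.norm_integral_le_of_norm_le_const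
    (C := (k * (2 * M) ^ (k - 1)) * (3 * M / (n + 1))) fun t ht => ?_).trans ?_
  · rw [Set.uIoc_of_le hle] at ht
    rw [Real.norm_eq_abs]
    refine (abs_pow_sub_pow_le_mul k (ρ := 2 * M) ?_ ?_).trans ?_
    · exact abs_le.2 ⟨by linarith [ht.1, hb.1], by linarith [ht.2, hb.2]⟩
    · linarith
    · gcongr
      have ha' := abs_le.1 ha
      have h2 : cellLeft M n j - cellPoint M n j = cellPoint M n j / (n + 1) := by
        simp only [cellLeft]; ring
      have h3 : |cellLeft M n j - cellPoint M n j| ≤ M / (n + 1) := by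
        rw [h2, abs_div, abs_of_pos (show (0 : ℝ) < n + 1 by positivity)]
        gcongr
      have h4 := abs_le.1 h3
      -- The dilation moves a cell point by at most `M / (n + 1)`, and the interval has length at
      -- most `2 * M / (n + 1)`.
      have h5 : 3 * M / ((n : ℝ) + 1) = M / (n + 1) + 2 * M / (n + 1) := by ring
      rw [h5]
      have h6 : 0 < 2 * M / ((n : ℝ) + 1) := by positivity
      exact abs_le.2 ⟨by linarith [ht.1, h4.1], by linarith [ht.2, h4.2, hm.2]⟩
  · rw [hlen, abs_of_pos hm.1, mul_comm]

omit hint in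
-- Both integrals are compared with a mass times the `k`-th power of the cell point; the last error
-- term accounts for the difference of the two masses.
theorem abs_interval_sub_cell_le (k : ℕ) (j : Fin (n + 1)) :
    |(∫ t in (cellLeft M n j)..(cellRight f M n j), t ^ k) -
      ∫ t in (cellPoint M n j)..(cellPoint M n (j + 1)), f t * t ^ k| ≤
    cellMass f M n j * ((k * (2 * M) ^ (k - 1)) * (3 * M / (n + 1))) +
    (∫ t in (cellPoint M n j)..(cellPoint M n (j + 1)), f t) *
      ((k * (2 * M) ^ (k - 1)) * (2 * M / (n + 1))) +
    (1 / (n + 1) + ∫ t in (cellPoint M n j)..(cellPoint M n (j + 1)), f t) *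
      ((2 * M) ^ k / (n + 1)) := by
  have h1 := abs_le.1 (abs_integral_interval_sub_le hf hf0 hf1 hM n k j)
  have h2 := abs_le.1 (abs_integral_cell_sub_le hf hf0 hf1 hM n k j j.2)
  have h0 := (integral_cell_mem hf hf0 hf1 hM n j).1
  have h3 : |(cellMass f M n j -
      ∫ t in (cellPoint M n j)..(cellPoint M n (j + 1)), f t) * cellPoint M n j ^ k| ≤
      (1 / (n + 1) + ∫ t in (cellPoint M n j)..(cellPoint M n (j + 1)), f t) *
        ((2 * M) ^ k / (n + 1)) := by
    have h4 : (cellMass f M n j -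
        ∫ t in (cellPoint M n j)..(cellPoint M n (j + 1)), f t) =
        (1 / (n + 1) - ∫ t in (cellPoint M n j)..(cellPoint M n (j + 1)), f t) / (n + 1) := by
      simp only [cellMass]; ring
    have h6 : (0 : ℝ) < 1 / (n + 1) := by positivity
    have h5 : |1 / ((n : ℝ) + 1) - ∫ t in (cellPoint M n j)..(cellPoint M n (j + 1)), f t| ≤
        1 / (n + 1) + ∫ t in (cellPoint M n j)..(cellPoint M n (j + 1)), f t :=
      abs_le.2 ⟨by linarith, by linarith⟩
    rw [h4, abs_mul, abs_div, abs_of_pos (show (0 : ℝ) < n + 1 by positivity), abs_pow,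
      div_mul_eq_mul_div, mul_div_assoc]
    gcongr
    linarith [abs_cellPoint_le hM n j.2.le]
  have h3 := abs_le.1 h3
  exact abs_le.2 ⟨by linarith [h1.1, h2.2, h3.1], by linarith [h1.2, h2.1, h3.2]⟩

theorem tendsto_integral_pow_cell (k : ℕ) :
    Tendsto (fun n => ∫ t, t ^ k ∂(unionMeasure (cellLeft M n) (cellRight f M n))) atTop
      (𝓝 (∫ t in (-M)..M, f t * t ^ k)) := by
  rw [tendsto_iff_dist_tendsto_zero]
  -- Both families of masses sum to one, so the Lipschitz errors add to `3 * M + 2 * M`; the mass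
  -- error contributes `1 + 1` times `(2 * M) ^ k`.
  have hlim : Tendsto (fun n : ℕ => (k * (2 * M) ^ (k - 1) * (5 * M) + 2 * (2 * M) ^ k) *
      (1 / ((n : ℝ) + 1))) atTop (𝓝 0) := by
    simpa using tendsto_one_div_add_atTop_nhds_zero_nat.const_mul
      (k * (2 * M) ^ (k - 1) * (5 * M) + 2 * (2 * M) ^ k)
  refine squeeze_zero (fun _ => dist_nonneg) (fun n => ?_) hlim
  have hn : (n : ℝ) + 1 ≠ 0 := by positivity
  have hs1 := sum_integral_cell hf hf0 hf1 hint n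
  have hs2 := sum_cellMass (M := M) hf hf0 hf1 hint n
  rw [Finset.sum_range] at hs1 hs2
  rw [Real.dist_eq, (isIntervalSystem_cell hf hf0 hf1 hM hint n).integral_unionMeasure
    (continuous_pow k), ← sum_integral_cell_mul hf hf0 hf1 n (continuous_pow k),
    Finset.sum_range, ← Finset.sum_sub_distrib]
  refine (Finset.abs_sum_le_sum_abs _ _).trans ((Finset.sum_le_sum fun j _ =>
    abs_interval_sub_cell_le hf hf0 hf1 hM n k j).trans (le_of_eq ?_))
  rw [Finset.sum_add_distrib, Finset.sum_add_distrib, ← Finset.sum_mul, ← Finset.sum_mul,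
    ← Finset.sum_mul, Finset.sum_add_distrib, hs1, hs2, Finset.sum_const, Finset.card_univ,
    Fintype.card_fin, nsmul_eq_mul]
  push_cast
  field_simp
  ring

end Cells

/-! ### The approximating sequence and the main theorem -/

theorem integral_pow_withDensity_eq {f : ℝ → ℝ} (hf : Measurable f) (hf0 : ∀ x, 0 ≤ f x) {M : ℝ}
    (hM : 0 ≤ M)
    (h : ∀ᵐ t ∂(volume.withDensity fun x => ENNReal.ofReal (f x)), |t| ≤ M) (k : ℕ) :
    ∫ t, t ^ k ∂(volume.withDensity fun x => ENNReal.ofReal (f x)) =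
      ∫ t in (-M)..M, f t * t ^ k := by
  rw [integral_withDensity_eq_integral_toReal_smul hf.ennreal_ofReal
      (.of_forall fun _ => ENNReal.ofReal_lt_top),
    intervalIntegral.integral_of_le (by linarith), ← integral_Icc_eq_integral_Ioc]
  rw [ae_withDensity_iff hf.ennreal_ofReal] at h
  simp only [ENNReal.toReal_ofReal (hf0 _), smul_eq_mul]
  refine (setIntegral_eq_integral_of_ae_compl_eq_zero (h.mono fun t ht hmem => ?_)).symm
  by_contra hne
  have h1 : f t ≠ 0 := left_ne_zero_of_mul hne
  exact hmem (abs_le.1 (ht (ENNReal.ofReal_pos.2 ((hf0 t).lt_of_ne' h1)).ne'))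

/-- The approximation is made for the preimage `μ`; its moments converge, and the exponential
relation transfers this to the images. -/
theorem exists_seq_intervalFamily {q : ℝ} (hq : q ∈ Set.Ioo (-1 : ℝ) 0 ∪ Set.Ioo (0 : ℝ) 1)
    {ν : ProbabilityMeasure ℝ} (hν : ν ∈ markovKreinImage q (BoundedDensity 1)) :
    ∃ u : ℕ → ProbabilityMeasure ℝ, (∀ n, u n ∈ intervalFamily q) ∧
      Tendsto u atTop (𝓝 ν) ∧
      ∀ k : ℕ, Tendsto (fun n => ∫ t : ℝ, t ^ k ∂(u n : Measure ℝ)) atTop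
        (𝓝 (∫ t : ℝ, t ^ k ∂(ν : Measure ℝ))) := by
  obtain ⟨μ, ⟨hμc, f, hf, hf01, hμf⟩, -, hνc, hexp⟩ := hν
  have hq0 : q ≠ 0 := by
    rcases hq with hq | hq
    · exact hq.2.ne
    · exact hq.1.ne'
  have hf0 : ∀ x, 0 ≤ f x := fun x => (hf01 x).1
  have hf1 : ∀ x, f x ≤ 1 := fun x => (hf01 x).2
  obtain ⟨M, hM, hμM⟩ := exists_ae_abs_le hμc
  obtain ⟨ρ, hρ, hνρ⟩ := exists_ae_abs_le hνc
  have hmom : ∀ k : ℕ, ∫ t, t ^ k ∂(μ : Measure ℝ) = ∫ t in (-M)..M, f t * t ^ k := by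
    intro k
    have hμM' := hμM
    rw [hμf] at hμM' ⊢
    exact integral_pow_withDensity_eq hf hf0 (by linarith) hμM' k
  have hint : ∫ t in (-M)..M, f t = 1 := by
    have := hmom 0
    simpa using this.symm
  have hsys := isIntervalSystem_cell hf hf0 hf1 hM hint
  have hl : ∀ n i, -(2 * M) ≤ cellLeft M n i := fun n i => (cell_bounds hf hf0 hf1 hM n i).1
  have hr : ∀ n i, cellRight f M n i ≤ 2 * M := fun n i => (cell_bounds hf hf0 hf1 hM n i).2
  have hPU := fun n => (hsys n).isProbabilityMeasure_unionMeasure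
  have hPI := fun n => (hsys n).isProbabilityMeasure_intervalMeasure hq
  have hbI := fun n => IsIntervalSystem.ae_abs_le_intervalMeasure (hl n) (hr n) q
  have hlim : ∀ k : ℕ, Tendsto
      (fun n => ∫ t : ℝ, t ^ k ∂(intervalMeasure q (cellLeft M n) (cellRight f M n))) atTop
      (𝓝 (∫ t : ℝ, t ^ k ∂(ν : Measure ℝ))) := by
    refine tendsto_of_exp_eq hq0
      (fun n => ⟨_, 2 * M, by linarith,
        abs_integral_pow_le (IsIntervalSystem.ae_abs_le_unionMeasure (hl n) (hr n))⟩)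
      (fun n => ⟨_, 2 * M, by linarith, abs_integral_pow_le (hbI n)⟩)
      ⟨_, M, by linarith, abs_integral_pow_le hμM⟩
      ⟨_, ρ, by linarith, abs_integral_pow_le hνρ⟩
      (fun n => (hsys n).eventually_exp_shiftSeries_eq (hl n) (hr n) hq) hexp fun k => ?_
    rw [hmom]
    exact tendsto_integral_pow_cell hf hf0 hf1 hM hint k
  refine ⟨fun n => ⟨intervalMeasure q (cellLeft M n) (cellRight f M n), hPI n⟩,
    fun n => ⟨n + 1, _, _, hsys n, rfl⟩, ?_, hlim⟩
  -- The radius `2 * M` contains all the approximants, and `ρ` the support of the limit.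
  exact tendsto_of_tendsto_integral_pow (ρ := max (2 * M) ρ)
    (fun n => (hbI n).mono fun t ht => ht.trans (le_max_left _ _))
    (hνρ.mono fun t ht => ht.trans (le_max_right _ _)) hlim

theorem mainTheorem11 (q : ℝ) (hq : q ∈ Set.Ioo (-1 : ℝ) 0 ∪ Set.Ioo (0 : ℝ) 1) :
    (∀ (r : ℕ) (α β : Fin r → ℝ), IsIntervalSystem α β →
      IsProbabilityMeasure (intervalMeasure q α β)) ∧
    intervalFamily q ⊆ markovKreinImage q (BoundedDensity 1) ∧
    markovKreinImage q (BoundedDensity 1) ⊆ closure (intervalFamily q) ∧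
    ∀ ν ∈ markovKreinImage q (BoundedDensity 1),
      ∃ u : ℕ → ProbabilityMeasure ℝ, (∀ n, u n ∈ intervalFamily q) ∧
        Tendsto u atTop (𝓝 ν) ∧
        ∀ k : ℕ, Tendsto (fun n => ∫ t : ℝ, t ^ k ∂(u n : Measure ℝ)) atTop
          (𝓝 (∫ t : ℝ, t ^ k ∂(ν : Measure ℝ))) := by
  refine ⟨fun r α β h => h.isProbabilityMeasure_intervalMeasure hq,
    intervalFamily_subset_markovKreinImage hq, fun ν hν => ?_,
    fun ν hν => exists_seq_intervalFamily hq hν⟩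
  obtain ⟨u, hu, hlim, -⟩ := exists_seq_intervalFamily hq hν
  exact mem_closure_of_tendsto hlim (.of_forall hu)
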